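/- **Setting.** All vector spaces are complex and $n,m,r$ range over the integers $\ge 1$; $M_{m,n}=M_{m,n}(\mathbb C)$ carries the operator norm. A *matrix order unit space* $(A,1)$ is a $*$-vector space $A$ with cones $M_n(A)^+\subseteq M_n(A)_{sa}$, $n\ge1$, such that $M_n(A)^+\cap(-M_n(A)^+)=\{0\}$ and $\gamma^*M_n(A)^+\gamma\subseteq M_m(A)^+$ for all $\gamma\in M_{n,m}$, together with an order unit $1=1^*$ of $A$ such that each cone $M_n(A)^+$ is Archimedean. The spaces $M_n(A)$ carry the norms $$\|a\|_n=\inf\Big\{t\ge 0:\begin{bmatrix}t1_n&a\\a^*&t1_n\end{bmatrix}\in M_{2n}(A)^+\Big\},$$ where $1_n$ is the diagonal matrix with entries $1$, and $A$ is assumed complete. Let $CS_n(A)$ be the set of unital completely positive linear maps $\varphi=[\varphi_{ij}]:A\to M_n$ (the matrix states), with the BW-topology (the topology of pointwise convergence on $A$), and put $\ll\varphi,a\gg\,=[\varphi_{ij}(a_{kl})]\in M_{nr}$ for $a=[a_{kl}]\in M_r(A)$. For a graded set $\mathbf S=(S_r)$, $S_r\subseteq M_r(A)$, put $$D_{\mathbf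 S,n}(\varphi,\psi)=\sup\{\|\ll\varphi,a\gg-\ll\psi,a\gg\|: a\in S_r,\ r\ge 1\}\in[0,\infty],\qquad \varphi,\psi\in CS_n(A).$$ A *matrix metric set* of $(A,1)$ is a graded set $\mathbf K=(K_n)$, $K_n\subseteq M_n(A)$, such that each $K_n$ is norm compact and $K_n^*=K_n$; $\mathbf K$ is absolutely matrix convex, i.e. $K_m\oplus K_n\subseteq K_{m+n}$ and $\alpha K_m\beta\subseteq K_n$ for all contractions $\alpha\in M_{n,m}$, $\beta\in M_{m,n}$; and $\mathbf K$ separates the matrix states, i.e. for $\varphi\ne\psi$ in $CS_n(A)$ there are $r$ and $a\in K_r$ with $\ll\varphi,a\gg\ne\ll\psi,a\gg$. A *matrix gauge* is a sequence $\mathcal L=(L_n)$ of maps $L_n:M_n(A)\to[0,\infty]$ with $L_n(v+w)\le L_n(v)+L_n(w)$, $L_n(cv)=|c|L_n(v)$ for $c\in\mathbb C$, $L_{m+n}(v\oplus w)=\max\{L_m(v),L_n(w)\}$ and $L_n(\alpha v\beta)\le\|\alpha\|L_m(v)\|\beta\|$ for $\alpha\in M_{n,m}$, $v\in M_m(A)$,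 $\beta\in M_{m,n}$ (with $0\cdot\infty=0$). For a matrix gauge $\mathcal L$ let $D_{L_n}=D_{\mathbf S,n}$ with $S_r=\{a\in M_r(A):L_r(a)\le1\}$. A *matrix Lip-gauge* is a matrix gauge such that, for every $n$: (1) $L_n(v)=0$ if and only if $v\in M_n(\mathbb C1)$; (2) $L_n(v^*)=L_n(v)$; (3) $\{a\in A:L_1(a)<\infty\}$ is norm dense in $A$; (4) the topology on $CS_n(A)$ defined by $D_{L_n}$ is the BW-topology. It is *lower semicontinuous* if each $L_n$ is lower semicontinuous for the norm of $M_n(A)$. **Corollary 4.4.** Let $(A,1)$ be a (complete) matrix order unit space and $\mathbf K=(K_n)$ a matrix metric set of $(A,1)$; write $D_{K_n}=D_{\mathbf K,n}$. Then there is a lower semicontinuous matrix Lip-gauge $\mathcal L=(L_n)$ on $(A,1)$ such that, for all $n\ge 1$ and $\varphi,\psi\in CS_n(A)$, $$D_{K_n}(\varphi,\psi)=\sup\{\|\ll\varphi,a\gg-\ll\psi,a\gg\|:L_r(a)\le1,\ r\ge 1\}<\infty .$$ -/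

import Mathlib

open scoped ENNReal Matrix ComplexOrder Matrix.Norms.L2Operator

noncomputable section

namespace MatOrd

/-- The product `α v β` of a scalar matrix, a matrix over a complex vector space `V`, and a scalar
matrix: its `(i, j)` entry is the sum over `k, l` of `α i k * β l j` times `v k l`. -/
def sandwich {V : Type*} [AddCommGroup V] [Module ℂ V] {m n p q : ℕ}
    (α : Matrix (Fin m) (Fin p) ℂ) (v : Matrix (Fin p) (Fin q) V)
    (β : Matrix (Fin q) (Fin n) ℂ) : Matrix (Fin m) (Fin n) V :=
  Matrix.of fun i j => ∑ k, ∑ l, (α i k * β l j) • v k l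

/-- The square block matrix with blocks `a, b` (first row) and `c, d` (second row), indexed by
`Fin (m + n)`. -/
def block {V : Type*} {m n : ℕ} (a : Matrix (Fin m) (Fin m) V) (b : Matrix (Fin m) (Fin n) V)
    (c : Matrix (Fin n) (Fin m) V) (d : Matrix (Fin n) (Fin n) V) :
    Matrix (Fin (m + n)) (Fin (m + n)) V :=
  Matrix.reindex finSumFinEquiv finSumFinEquiv (Matrix.fromBlocks a b c d)

/-- The direct sum `v ⊕ w`. -/
def directSum {V : Type*} [Zero V] {m n : ℕ} (v : Matrix (Fin m) (Fin m) V)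
    (w : Matrix (Fin n) (Fin n) V) : Matrix (Fin (m + n)) (Fin (m + n)) V :=
  block v 0 0 w

/-- A matrix order unit space `(A, 1)`. The set `pos n` is the positive cone of `M_n(A)`, and
`x ≤ y` in `M_n(A)` means that `y - x` lies in `pos n`. The matrix `1` in `M_n(A)` is the diagonal
matrix with all diagonal entries equal to the order unit `1`. The norm of `A` is the one
determined by the order (`norm_eq`); completeness is a separate assumption.
The level `n = 0`, where `M_0(A) = {0}`, carries no information. -/
class MatrixOrderUnitSpace (A : Type*) [NormedAddCommGroup A] [NormedSpace ℂ A]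
    [StarAddMonoid A] [StarModule ℂ A] [One A] where
  pos : ∀ n : ℕ, Set (Matrix (Fin n) (Fin n) A)
  isSelfAdjoint_of_pos : ∀ {n : ℕ} {a : Matrix (Fin n) (Fin n) A}, a ∈ pos n → aᴴ = a
  zero_mem : ∀ n : ℕ, 0 ∈ pos n
  add_mem : ∀ {n : ℕ} {a b : Matrix (Fin n) (Fin n) A}, a ∈ pos n → b ∈ pos n → a + b ∈ pos n
  smul_mem : ∀ {n : ℕ} {a : Matrix (Fin n) (Fin n) A} {t : ℝ}, 0 ≤ t → a ∈ pos n →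
    (t : ℂ) • a ∈ pos n
  proper : ∀ {n : ℕ} {a : Matrix (Fin n) (Fin n) A}, a ∈ pos n → -a ∈ pos n → a = 0
  compress : ∀ {n m : ℕ} {a : Matrix (Fin n) (Fin n) A} (γ : Matrix (Fin n) (Fin m) ℂ),
    a ∈ pos n → sandwich γᴴ a γ ∈ pos m
  star_one : star (1 : A) = 1
  orderUnit : ∀ a : A, star a = a → ∃ t : ℝ, 0 < t ∧ !![(t : ℂ) • (1 : A) - a] ∈ pos 1
  archimedean : ∀ {n : ℕ} {a : Matrix (Fin n) (Fin n) A},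
    (∀ ε : ℝ, 0 < ε → a + (ε : ℂ) • (1 : Matrix (Fin n) (Fin n) A) ∈ pos n) → a ∈ pos n
  norm_eq : ∀ a : A, ‖a‖ =
    sInf {t : ℝ | 0 ≤ t ∧ !![(t : ℂ) • (1 : A), a; star a, (t : ℂ) • (1 : A)] ∈ pos 2}

/-- The matrix pairing of a linear map `φ : V → M_n`, seen as the `n × n` matrix of functionals
`φ_ij`, with `a` in `M_r(V)`: the `((i, k), (j, l))` entry is `φ_ij (a k l)`. -/
def pairing {V : Type*} [AddCommGroup V] [Module ℂ V] {n r : ℕ}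
    (φ : V →ₗ[ℂ] Matrix (Fin n) (Fin n) ℂ) (a : Matrix (Fin r) (Fin r) V) :
    Matrix (Fin n × Fin r) (Fin n × Fin r) ℂ :=
  Matrix.of fun p q => φ (a p.2 q.2) p.1 q.1

section

variable (A : Type*) [NormedAddCommGroup A] [NormedSpace ℂ A] [StarAddMonoid A] [StarModule ℂ A]
  [One A] [MatrixOrderUnitSpace A]

/-- The norm of `M_n(A)` determined by the matrix order: the infimum of the `t` for which the
block matrix with rows `t1, a` and `a*, t1` is positive in `M_{2n}(A)`. -/
def matNorm (n : ℕ) (a : Matrix (Fin n) (Fin n) A) : ℝ :=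
  sInf {t : ℝ | 0 ≤ t ∧
    block ((t : ℂ) • (1 : Matrix (Fin n) (Fin n) A)) a aᴴ ((t : ℂ) • 1)
      ∈ MatrixOrderUnitSpace.pos (n + n)}

/-- The norm topology of `M_n(A)`: a set is open when it contains a norm ball around each of its
points. -/
abbrev normTopology (n : ℕ) : TopologicalSpace (Matrix (Fin n) (Fin n) A) where
  IsOpen U := ∀ a ∈ U, ∃ ε : ℝ, 0 < ε ∧ ∀ b, matNorm A n (b - a) < ε → b ∈ U
  isOpen_univ := fun _ _ => ⟨1, one_pos, fun _ _ => trivial⟩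
  isOpen_inter := by
    rintro U V hU hV a ⟨haU, haV⟩
    obtain ⟨ε, hε, h⟩ := hU a haU
    obtain ⟨δ, hδ, h'⟩ := hV a haV
    exact ⟨min ε δ, lt_min hε hδ, fun b hb =>
      ⟨h b (hb.trans_le (min_le_left _ _)), h' b (hb.trans_le (min_le_right _ _))⟩⟩
  isOpen_sUnion := by
    rintro S hS a ⟨U, hU, haU⟩
    obtain ⟨ε, hε, h⟩ := hS U hU a haU
    exact ⟨ε, hε, fun b hb => ⟨U, hU, h b hb⟩⟩

/-- The matrix states `CS_n(A)`: the unital completely positive linear maps from `A` to `M_n`. -/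
def MatrixState (n : ℕ) : Type _ :=
  {φ : A →ₗ[ℂ] Matrix (Fin n) (Fin n) ℂ // φ 1 = 1 ∧
    ∀ (r : ℕ) (a : Matrix (Fin r) (Fin r) A), a ∈ MatrixOrderUnitSpace.pos r →
      (pairing φ a).PosSemidef}

/-- The BW-topology on `CS_n(A)`: the topology of pointwise (weak operator, that is, entrywise)
convergence on `A`. -/
abbrev bwTopology (n : ℕ) : TopologicalSpace (MatrixState A n) :=
  TopologicalSpace.induced (fun φ (a : A) (i j : Fin n) => φ.1 a i j) inferInstance

variable {A}

/-- For a graded set `S`, the supremum in `[0, ∞]` of the norms of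
`⟪φ, a⟫ - ⟪ψ, a⟫` over all `a ∈ S r` and all `r ≥ 1`. -/
def stateDist (S : ∀ r : ℕ, Set (Matrix (Fin r) (Fin r) A)) (n : ℕ) (φ ψ : MatrixState A n) :
    ℝ≥0∞ :=
  ⨆ (r : ℕ) (_ : 0 < r), ⨆ a ∈ S r, ‖pairing φ.1 a - pairing ψ.1 a‖ₑ

/-- The (extended pseudo-)metric structure on `CS_n(A)` given by `stateDist S n`. -/
abbrev stateEMetric (S : ∀ r : ℕ, Set (Matrix (Fin r) (Fin r) A)) (n : ℕ) :
    PseudoEMetricSpace (MatrixState A n) where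
  edist := stateDist S n
  edist_self φ := by simp [stateDist]
  edist_comm φ ψ := by
    simp only [stateDist]
    refine iSup_congr fun r => iSup_congr fun _ => iSup_congr fun a => iSup_congr fun _ => ?_
    rw [← enorm_neg, neg_sub]
  edist_triangle φ ψ χ := by
    refine iSup_le fun r => iSup_le fun hr => iSup_le fun a => iSup_le fun ha => ?_
    have key : ∀ ρ σ : MatrixState A n,
        ‖pairing ρ.1 a - pairing σ.1 a‖ₑ ≤ stateDist S n ρ σ := fun ρ σ =>
      le_iSup_of_le r (le_iSup_of_le hr (le_iSup_of_le a (le_iSup_of_le ha le_rfl)))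
    have e : pairing φ.1 a - pairing χ.1 a
        = (pairing φ.1 a - pairing ψ.1 a) + (pairing ψ.1 a - pairing χ.1 a) := by abel
    rw [e]
    exact (enorm_add_le _ _).trans (add_le_add (key φ ψ) (key ψ χ))

/-- The topology on `CS_n(A)` of the (extended pseudo-)metric `stateDist S n`. -/
abbrev stateTopology (S : ∀ r : ℕ, Set (Matrix (Fin r) (Fin r) A)) (n : ℕ) :
    TopologicalSpace (MatrixState A n) :=
  (stateEMetric S n).toUniformSpace.toTopologicalSpace

/-- Matrix metric sets: graded sets `K_n ⊆ M_n(A)`, `n ≥ 1`, that are norm compact, self-adjoint,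
absolutely matrix convex, and separate the matrix states. -/
structure IsMatrixMetricSet (K : ∀ n : ℕ, Set (Matrix (Fin n) (Fin n) A)) : Prop where
  isCompact : ∀ n : ℕ, 0 < n → @IsCompact _ (normTopology A n) (K n)
  star_mem : ∀ n : ℕ, 0 < n → ∀ a ∈ K n, aᴴ ∈ K n
  directSum_mem : ∀ m n : ℕ, 0 < m → 0 < n → ∀ a ∈ K m, ∀ b ∈ K n, directSum a b ∈ K (m + n)
  sandwich_mem : ∀ m n : ℕ, 0 < m → 0 < n →
    ∀ (α : Matrix (Fin n) (Fin m) ℂ) (β : Matrix (Fin m) (Fin n) ℂ), ‖α‖ ≤ 1 → ‖β‖ ≤ 1 →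
      ∀ a ∈ K m, sandwich α a β ∈ K n
  separates : ∀ n : ℕ, 0 < n → ∀ φ ψ : MatrixState A n, φ ≠ ψ →
    ∃ r : ℕ, 0 < r ∧ ∃ a ∈ K r, pairing φ.1 a ≠ pairing ψ.1 a

/-- Matrix gauges `G = (G_n)`, `n ≥ 1`, with values in `[0, ∞]` and the convention `0 * ∞ = 0`. -/
structure IsMatrixGauge (G : ∀ n : ℕ, Matrix (Fin n) (Fin n) A → ℝ≥0∞) : Prop where
  add_le : ∀ n : ℕ, 0 < n → ∀ v w, G n (v + w) ≤ G n v + G n w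
  smul_eq : ∀ n : ℕ, 0 < n → ∀ (c : ℂ) v, G n (c • v) = ‖c‖ₑ * G n v
  directSum_eq : ∀ m n : ℕ, 0 < m → 0 < n → ∀ v w,
    G (m + n) (directSum v w) = max (G m v) (G n w)
  sandwich_le : ∀ m n : ℕ, 0 < m → 0 < n →
    ∀ (α : Matrix (Fin n) (Fin m) ℂ) (v) (β : Matrix (Fin m) (Fin n) ℂ),
      G n (sandwich α v β) ≤ ‖α‖ₑ * G m v * ‖β‖ₑ

/-- The graded unit ball `{a | G_r a ≤ 1}` of a sequence of gauges. -/
def unitBall (G : ∀ n : ℕ, Matrix (Fin n) (Fin n) A → ℝ≥0∞) (r : ℕ) :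
    Set (Matrix (Fin r) (Fin r) A) :=
  {a | G r a ≤ 1}

/-- Matrix Lip-gauges on `(A, 1)`. -/
structure IsMatrixLipGauge (G : ∀ n : ℕ, Matrix (Fin n) (Fin n) A → ℝ≥0∞) : Prop
    extends IsMatrixGauge G where
  eq_zero_iff : ∀ n : ℕ, 0 < n → ∀ v : Matrix (Fin n) (Fin n) A,
    G n v = 0 ↔ ∃ c : Matrix (Fin n) (Fin n) ℂ, v = c.map fun z => z • (1 : A)
  star_eq : ∀ n : ℕ, 0 < n → ∀ v, G n vᴴ = G n v
  dense : Dense {a : A | G 1 !![a] < ∞}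
  topology_eq : ∀ n : ℕ, 0 < n → stateTopology (unitBall G) n = bwTopology A n

end

end MatOrd

end

namespace MatOrd

/-! The gauge `gaugeOf K` is the Minkowski functional of `K` enlarged by the scalar matrices. Unital
maps agree on scalar matrices, so the enlargement changes no distance
(`stateDist_unitBall_gaugeOf`), while it makes the kernel exactly the scalars. Since `K n` is
compact and the scalar matrices form a closed finite-dimensional subspace, the dilates of the
enlarged set are closed; the infimum is therefore attained (`gaugeOf_le_iff`), lower semicontinuity
follows, and the gauge axioms become closure properties of `K` under direct sums and contractions.

For the topology, everything reduces to the compact set `K 1`: compressing a matrix in `K r` by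
vectors lands in multiples of `K 1`, so a functional bounded by `ε` on `K 1` has amplifications
bounded by `ε` on every `K r` (`norm_map_le_of_le_on_one`). States are entrywise contractive, so a
finite net of `K 1` shows that BW-neighbourhoods control the distance. Conversely, the distance
controls the states on the span of `1` and `K 1`, which suffices because that span is dense.

The density (`dense_of_separates_states`) is a Hahn-Banach argument: a nonzero functional vanishing
on the span would have a Jordan decomposition (`exists_positive_sub`) whose two parts, normalised,
are distinct states agreeing on the span, against separation. -/

lemma isOpen_pi_pi_iff {E : Type*} [SeminormedAddCommGroup E] {n : ℕ}
    (U : Set (Fin n → Fin n → E)) :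
    IsOpen U ↔ ∀ a ∈ U, ∃ ε : ℝ, 0 < ε ∧ ∀ b, (∀ i j, ‖b i j - a i j‖ < ε) → b ∈ U := by
  rw [Metric.isOpen_iff]
  refine forall₂_congr fun a _ => exists_congr fun ε => and_congr_right fun hε =>
    forall_congr' fun b => ?_
  simp only [Metric.mem_ball, dist_pi_lt_iff hε]
  simp only [dist_eq_norm]

/-! ### Entries of compressions and of block matrices. -/

section Sandwich

variable {V : Type*} {m n : ℕ}

lemma sandwich_apply [AddCommGroup V] [Module ℂ V] {p q : ℕ} (α : Matrix (Fin m) (Fin p) ℂ) (v : Matrix (Fin p) (Fin q) V)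
    (β : Matrix (Fin q) (Fin n) ℂ) (i : Fin m) (j : Fin n) :
    sandwich α v β i j = ∑ k, ∑ l, (α i k * β l j) • v k l := rfl

@[simp]
lemma block_castAdd_castAdd (a : Matrix (Fin m) (Fin m) V) (b : Matrix (Fin m) (Fin n) V)
    (c : Matrix (Fin n) (Fin m) V) (d : Matrix (Fin n) (Fin n) V) (i j : Fin m) :
    block a b c d (Fin.castAdd n i) (Fin.castAdd n j) = a i j := by
  simp [block]

@[simp]
lemma block_castAdd_natAdd (a : Matrix (Fin m) (Fin m) V) (b : Matrix (Fin m) (Fin n) V)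
    (c : Matrix (Fin n) (Fin m) V) (d : Matrix (Fin n) (Fin n) V) (i : Fin m) (j : Fin n) :
    block a b c d (Fin.castAdd n i) (Fin.natAdd m j) = b i j := by
  simp [block]

@[simp]
lemma block_natAdd_castAdd (a : Matrix (Fin m) (Fin m) V) (b : Matrix (Fin m) (Fin n) V)
    (c : Matrix (Fin n) (Fin m) V) (d : Matrix (Fin n) (Fin n) V) (i : Fin n) (j : Fin m) :
    block a b c d (Fin.natAdd m i) (Fin.castAdd n j) = c i j := by
  simp [block]

@[simp]
lemma block_natAdd_natAdd (a : Matrix (Fin m) (Fin m) V) (b : Matrix (Fin m) (Fin n) V)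
    (c : Matrix (Fin n) (Fin m) V) (d : Matrix (Fin n) (Fin n) V) (i j : Fin n) :
    block a b c d (Fin.natAdd m i) (Fin.natAdd m j) = d i j := by
  simp [block]

lemma ext_castAdd_natAdd {a b : Matrix (Fin (m + n)) (Fin (m + n)) V}
    (h₁ : ∀ i j, a (Fin.castAdd n i) (Fin.castAdd n j) = b (Fin.castAdd n i) (Fin.castAdd n j))
    (h₂ : ∀ i j, a (Fin.castAdd n i) (Fin.natAdd m j) = b (Fin.castAdd n i) (Fin.natAdd m j))
    (h₃ : ∀ i j, a (Fin.natAdd m i) (Fin.castAdd n j) = b (Fin.natAdd m i) (Fin.castAdd n j))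
    (h₄ : ∀ i j, a (Fin.natAdd m i) (Fin.natAdd m j) = b (Fin.natAdd m i) (Fin.natAdd m j)) :
    a = b := by
  ext i j
  induction i using Fin.addCases with
  | left i => induction j using Fin.addCases with
    | left j => exact h₁ i j
    | right j => exact h₂ i j
  | right i => induction j using Fin.addCases with
    | left j => exact h₃ i j
    | right j => exact h₄ i j

end Sandwich

/-! ### Order-theoretic estimates: the matrix norm induces the entrywise topology. -/

section Order

variable {A : Type*} [NormedAddCommGroup A] [NormedSpace ℂ A] [StarAddMonoid A] [StarModule ℂ A]
  [One A] [MatrixOrderUnitSpace A]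

open MatrixOrderUnitSpace

lemma rankOne_mem_pos {n : ℕ} {x : A} (hx : !![x] ∈ pos 1) (γ : Fin n → ℂ) :
    (Matrix.of fun i j => (star (γ i) * γ j) • x) ∈ (pos n : Set (Matrix _ _ A)) := by
  have h := compress (Matrix.of fun _ : Fin 1 => γ) hx
  convert h using 1
  ext i j
  simp [-Fin.natAdd_eq_addNat, sandwich_apply]

lemma sum_mem_pos {n : ℕ} {ι : Type*} (s : Finset ι) (f : ι → Matrix (Fin n) (Fin n) A)
    (h : ∀ i ∈ s, f i ∈ pos n) : ∑ i ∈ s, f i ∈ pos n :=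
  Finset.sum_induction f (· ∈ pos n) (fun _ _ => add_mem) (zero_mem n) h

/-- Positivity of the unit is not an axiom; it comes from the order unit property at `0`, after
rescaling. -/
lemma one_mem_pos_one : !![(1 : A)] ∈ pos 1 := by
  obtain ⟨t, ht, h⟩ := orderUnit (0 : A) (star_zero A)
  have h' := smul_mem (inv_nonneg.2 ht.le) h
  convert h' using 1
  ext i j
  fin_cases i; fin_cases j
  simp [smul_smul, ht.ne', -Complex.ofReal_inv]

lemma diagonal_mem_pos {n : ℕ} (d : Fin n → ℝ) (hd : ∀ i, 0 ≤ d i) :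
    Matrix.diagonal (fun i => (d i : ℂ) • (1 : A)) ∈ pos n := by
  have h := sum_mem_pos Finset.univ _ fun k (_ : k ∈ Finset.univ) =>
    smul_mem (hd k) (rankOne_mem_pos (one_mem_pos_one (A := A)) (Pi.single k (1 : ℂ)))
  convert h using 1
  ext i j
  rw [Matrix.sum_apply]
  by_cases hij : i = j
  · subst hij
    rw [Finset.sum_eq_single i]
    · simp
    · intro b _ hb
      simp [Pi.single_apply, hb.symm]
    · simp
  · rw [Finset.sum_eq_zero]
    · simp [hij]
    · intro k _
      by_cases hk : i = k
      · subst hk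
        simp [Pi.single_apply, Ne.symm hij]
      · simp [Pi.single_apply, hk]

/-- The off-diagonal square matrix of a self-adjoint element, with a phase. -/
lemma phase_mem_pos_two {x : A} {t : ℝ} {c : ℂ} (hc : star c * c = 1)
    (h₁ : !![(t : ℂ) • (1 : A) + x] ∈ pos 1) (h₂ : !![(t : ℂ) • (1 : A) - x] ∈ pos 1) :
    !![(t : ℂ) • (1 : A), c • x; star c • x, (t : ℂ) • (1 : A)] ∈ pos 2 := by
  -- Average of the compressions of `t + x` by the row `(1, c)` and of `t - x` by `(1, -c)`: the
  -- diagonal `x` terms and the off-diagonal `t` terms cancel.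
  have h := smul_mem (t := 1 / 2) (by norm_num)
    (add_mem (rankOne_mem_pos h₁ ![1, c]) (rankOne_mem_pos h₂ ![1, -c]))
  have hc' : (starRingEnd ℂ) c * c = 1 := hc
  convert h using 1
  ext i j
  fin_cases i <;> fin_cases j <;> simp [hc'] <;> module

lemma exists_add_sub_mem_pos (x : A) (hx : star x = x) : ∃ t : ℝ, 0 < t ∧
    !![(t : ℂ) • (1 : A) + x] ∈ pos 1 ∧ !![(t : ℂ) • (1 : A) - x] ∈ pos 1 := by
  obtain ⟨t, ht, h⟩ := orderUnit x hx
  obtain ⟨s, hs, h'⟩ := orderUnit (-x) (by rw [star_neg, hx])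
  have hsm := smul_mem hs.le (one_mem_pos_one (A := A))
  have htm := smul_mem ht.le (one_mem_pos_one (A := A))
  refine ⟨t + s, by positivity, ?_, ?_⟩
  · convert add_mem htm h' using 1
    ext i j
    fin_cases i; fin_cases j
    simp; module
  · convert add_mem hsm h using 1
    ext i j
    fin_cases i; fin_cases j
    simp; module

/-- The real part enters with phase `1` and the imaginary part with phase `i`. This makes the set
whose infimum defines the norm nonempty. -/
lemma exists_mem_pos_two (a : A) : ∃ t : ℝ, 0 ≤ t ∧
    !![(t : ℂ) • (1 : A), a; star a, (t : ℂ) • (1 : A)] ∈ pos 2 := by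
  obtain ⟨t, ht, h₁, h₂⟩ := exists_add_sub_mem_pos (realPart a : A) (realPart a).2
  obtain ⟨s, hs, h₃, h₄⟩ := exists_add_sub_mem_pos (imaginaryPart a : A) (imaginaryPart a).2
  have h := add_mem (phase_mem_pos_two (c := 1) (by simp) h₁ h₂)
    (phase_mem_pos_two (c := Complex.I) (by simp) h₃ h₄)
  refine ⟨t + s, by positivity, ?_⟩
  convert h using 1
  have e := realPart_add_I_smul_imaginaryPart a
  ext i j
  fin_cases i <;> fin_cases j
  · simp; module
  · simp [e]
  · have e' := congrArg star e
    simp at e' ⊢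
    rw [← e']
  · simp; module

lemma norm_le_of_mem_pos_two {a : A} {t : ℝ} (ht : 0 ≤ t)
    (h : !![(t : ℂ) • (1 : A), a; star a, (t : ℂ) • (1 : A)] ∈ pos 2) : ‖a‖ ≤ t := by
  rw [norm_eq]
  exact csInf_le ⟨0, fun _ h => h.1⟩ ⟨ht, h⟩

lemma mem_pos_two_of_norm_lt {a : A} {t : ℝ} (h : ‖a‖ < t) :
    !![(t : ℂ) • (1 : A), a; star a, (t : ℂ) • (1 : A)] ∈ pos 2 := by
  rw [norm_eq] at h
  obtain ⟨s, ⟨hs, hs'⟩, hst⟩ := exists_lt_of_csInf_lt (exists_mem_pos_two a) h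
  convert add_mem hs' (diagonal_mem_pos (A := A) (n := 2) (fun _ => t - s)
    fun _ => sub_nonneg.2 hst.le) using 1
  ext i j
  fin_cases i <;> fin_cases j <;> simp <;> module

lemma block_single_mem_pos {n : ℕ} {a : A} {t : ℝ} (h : ‖a‖ < t) (i j : Fin n) :
    block ((t : ℂ) • (1 : Matrix (Fin n) (Fin n) A)) (Matrix.single i j a) (Matrix.single i j a)ᴴ
      ((t : ℂ) • 1) ∈ pos (n + n) := by
  have ht : 0 ≤ t := (norm_nonneg a).trans h.le
  have h₁ := compress (Matrix.of ![Pi.single (Fin.castAdd n i) 1, Pi.single (Fin.natAdd n j) 1])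
    (mem_pos_two_of_norm_lt h)
  -- The compression `h₁` already puts `t` at row `i` of the first block and row `j` of the second,
  -- so the padding is `0` there and `t` elsewhere.
  have h₂ := diagonal_mem_pos (A := A) (n := n + n)
    (Fin.addCases (fun k => if k = i then 0 else t) (fun k => if k = j then 0 else t))
    (fun k => by
      induction k using Fin.addCases <;> simp [-Fin.natAdd_eq_addNat] <;> split_ifs <;> simp [ht])
  have ne : ∀ k l : Fin n, Fin.castAdd n k ≠ Fin.natAdd n l := fun k l h => by
    have := congrArg Fin.val h
    simp at this
    omega
  have e := add_mem h₁ h₂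
  convert e using 1
  refine ext_castAdd_natAdd ?_ ?_ ?_ ?_ <;> intro k l
  · by_cases hkl : k = l
    · subst hkl
      by_cases hk : k = i
      · subst hk
        simp [-Fin.natAdd_eq_addNat, sandwich_apply, Fin.sum_univ_two, ne]
      · simp [-Fin.natAdd_eq_addNat, sandwich_apply, Fin.sum_univ_two, ne, hk]
    · by_cases hk : k = i
      · subst hk
        simp [-Fin.natAdd_eq_addNat, sandwich_apply, Fin.sum_univ_two, ne, hkl, Ne.symm hkl]
      · simp [-Fin.natAdd_eq_addNat, sandwich_apply, Fin.sum_univ_two, Pi.single_apply, ne, hk, hkl]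
  · simp [-Fin.natAdd_eq_addNat, sandwich_apply, Fin.sum_univ_two, Pi.single_apply, ne, (ne _ _).symm, Matrix.single_apply,
      ite_and, eq_comm]
    split_ifs <;> simp
  · simp [-Fin.natAdd_eq_addNat, sandwich_apply, Fin.sum_univ_two, Pi.single_apply, ne, (ne _ _).symm, Matrix.single_apply,
      ite_and, eq_comm]
    split_ifs <;> simp
  · by_cases hkl : k = l
    · subst hkl
      by_cases hk : k = j
      · subst hk
        simp [-Fin.natAdd_eq_addNat, sandwich_apply, Fin.sum_univ_two, (ne _ _).symm]
      · simp [-Fin.natAdd_eq_addNat, sandwich_apply, Fin.sum_univ_two, (ne _ _).symm, hk]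
    · by_cases hk : k = j
      · subst hk
        simp [-Fin.natAdd_eq_addNat, sandwich_apply, Fin.sum_univ_two, (ne _ _).symm, hkl, Ne.symm hkl]
      · simp [-Fin.natAdd_eq_addNat, sandwich_apply, Fin.sum_univ_two, Pi.single_apply, (ne _ _).symm, hk, hkl]

variable (A) in
/-- The pairs `(t, a)` for which the block matrix with rows `t, a` and `a*, t` is positive. -/
def blockCone (n : ℕ) : AddSubmonoid (ℝ × Matrix (Fin n) (Fin n) A) where
  carrier := {p | block ((p.1 : ℂ) • (1 : Matrix (Fin n) (Fin n) A)) p.2 p.2ᴴ ((p.1 : ℂ) • 1)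
    ∈ pos (n + n)}
  zero_mem' := by
    change block _ _ _ _ ∈ pos (n + n)
    convert MatrixOrderUnitSpace.zero_mem (A := A) (n + n) using 1
    refine ext_castAdd_natAdd ?_ ?_ ?_ ?_ <;> simp [-Fin.natAdd_eq_addNat]
  add_mem' := by
    rintro ⟨s, a⟩ ⟨t, b⟩ h₁ h₂
    change block _ _ _ _ ∈ pos (n + n)
    convert MatrixOrderUnitSpace.add_mem h₁ h₂ using 1
    refine ext_castAdd_natAdd ?_ ?_ ?_ ?_ <;> simp [-Fin.natAdd_eq_addNat, add_smul]

/-- The matrix is a sum of `n * n` single-entry matrices, each contributing `ε` to the scalar corner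
of `blockCone`. -/
lemma block_mem_pos_of_norm_lt {n : ℕ} {a : Matrix (Fin n) (Fin n) A} {ε : ℝ}
    (h : ∀ i j, ‖a i j‖ < ε) :
    block ((((n * n : ℕ) * ε : ℝ) : ℂ) • (1 : Matrix (Fin n) (Fin n) A)) a aᴴ
      ((((n * n : ℕ) * ε : ℝ) : ℂ) • 1) ∈ pos (n + n) := by
  have hs : ∑ i : Fin n, ∑ j : Fin n, (ε, Matrix.single i j (a i j)) ∈ blockCone A n :=
    sum_mem fun i _ => sum_mem fun j _ => block_single_mem_pos (h i j) i j
  have e : ∑ i : Fin n, ∑ j : Fin n, (ε, Matrix.single i j (a i j))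
      = (((n * n : ℕ) : ℝ) * ε, a) := by
    ext1
    · simp [Prod.fst_sum, mul_assoc]
    · simp only [Prod.snd_sum]
      exact (Matrix.matrix_eq_sum_single a).symm
  rw [e] at hs
  exact hs

lemma matNorm_le {n : ℕ} {a : Matrix (Fin n) (Fin n) A} {ε : ℝ} (hε : 0 ≤ ε)
    (h : ∀ i j, ‖a i j‖ < ε) : matNorm A n a ≤ (n * n : ℕ) * ε :=
  csInf_le ⟨0, fun _ h => h.1⟩ ⟨by positivity, block_mem_pos_of_norm_lt h⟩

lemma norm_apply_le_matNorm {n : ℕ} (a : Matrix (Fin n) (Fin n) A) (i j : Fin n) :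
    ‖a i j‖ ≤ matNorm A n a := by
  refine le_csInf ⟨(n * n : ℕ) * (∑ i, ∑ j, ‖a i j‖ + 1), by positivity,
    block_mem_pos_of_norm_lt fun i j => ?_⟩ ?_
  · have h₁ : ‖a i j‖ ≤ ∑ j, ‖a i j‖ :=
      Finset.single_le_sum (f := fun j => ‖a i j‖) (fun _ _ => norm_nonneg _) (Finset.mem_univ j)
    have h₂ : ∑ j, ‖a i j‖ ≤ ∑ i, ∑ j, ‖a i j‖ :=
      Finset.single_le_sum (f := fun i => ∑ j, ‖a i j‖)
        (fun _ _ => Finset.sum_nonneg fun _ _ => norm_nonneg _) (Finset.mem_univ i)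
    linarith
  · rintro t ⟨ht, h⟩
    refine norm_le_of_mem_pos_two ht ?_
    -- Compressing to the indices `i` and `n + j` isolates the entry `a i j` with `t` on the
    -- diagonal.
    have h' := compress (Matrix.of fun p (q : Fin 2) =>
      (![Pi.single (Fin.castAdd n i) 1, Pi.single (Fin.natAdd n j) 1] : Fin 2 → _ → ℂ) q p) h
    convert h' using 1
    ext k l
    fin_cases k <;> fin_cases l <;>
      simp [-Fin.natAdd_eq_addNat, sandwich_apply, Pi.single_apply]

/-- The two entrywise bounds make the norms equivalent, so compactness and semicontinuity can be
treated in the product topology. -/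
lemma normTopology_eq (n : ℕ) :
    normTopology A n = (inferInstance : TopologicalSpace (Matrix (Fin n) (Fin n) A)) := by
  ext U
  refine Iff.trans ?_ (isOpen_pi_pi_iff U).symm
  change (∀ a ∈ U, ∃ ε : ℝ, 0 < ε ∧ ∀ b, matNorm A n (b - a) < ε → b ∈ U) ↔
    ∀ a ∈ U, ∃ ε : ℝ, 0 < ε ∧ ∀ b : Matrix (Fin n) (Fin n) A,
      (∀ i j, ‖(b - a) i j‖ < ε) → b ∈ U
  refine forall₂_congr fun a _ => ⟨?_, ?_⟩
  · rintro ⟨ε, hε, h⟩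
    have hδ : 0 < ε / ((n * n : ℕ) + 1) := by positivity
    refine ⟨_, hδ, fun b hb => h b ((matNorm_le hδ.le hb).trans_lt ?_)⟩
    rw [mul_div_assoc', div_lt_iff₀ (by positivity)]
    nlinarith
  · rintro ⟨ε, hε, h⟩
    exact ⟨ε, hε, fun b hb => h b fun i j => (norm_apply_le_matNorm (b - a) i j).trans_lt hb⟩

end Order

lemma pairing_apply {V : Type*} [AddCommGroup V] [Module ℂ V] {n r : ℕ}
    (φ : V →ₗ[ℂ] Matrix (Fin n) (Fin n) ℂ)
    (a : Matrix (Fin r) (Fin r) V) (p q : Fin n × Fin r) :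
    pairing φ a p q = φ (a p.2 q.2) p.1 q.1 := rfl

/-! ### Complex functionals from real ones on the self-adjoint part. -/

section Complexify

variable {A : Type*} [NormedAddCommGroup A] [NormedSpace ℂ A] [StarAddMonoid A] [StarModule ℂ A]

/-- A complex functional from a real functional on the self-adjoint elements. -/
noncomputable def complexify (g : selfAdjoint A →ₗ[ℝ] ℝ) : A →ₗ[ℂ] ℂ where
  toFun a := g (realPart a) + Complex.I * g (imaginaryPart a)
  map_add' a b := by simp; ring
  map_smul' c a := by
    rw [realPart_smul, imaginaryPart_smul]
    apply Complex.ext <;> simp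

lemma complexify_apply (g : selfAdjoint A →ₗ[ℝ] ℝ) (a : A) :
    complexify g a = g (realPart a) + Complex.I * g (imaginaryPart a) := rfl

lemma complexify_star (g : selfAdjoint A →ₗ[ℝ] ℝ) (a : A) :
    complexify g (star a) = star (complexify g a) := by
  have h₁ : realPart (star a) = realPart a := by
    ext; simp [realPart_apply_coe, add_comm]
  have h₂ : imaginaryPart (star a) = -imaginaryPart a := by
    ext; simp [imaginaryPart_apply_coe, smul_sub, ← smul_neg]
  rw [complexify_apply, complexify_apply, h₁, h₂]
  simp

lemma complexify_coe (g : selfAdjoint A →ₗ[ℝ] ℝ) (a : selfAdjoint A) :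
    complexify g a = g a := by
  simp [complexify_apply]

end Complexify

/-! ### States: contractivity, Jordan decomposition and density of separating subspaces. -/

section States

variable {A : Type*} [NormedAddCommGroup A] [NormedSpace ℂ A] [StarAddMonoid A] [StarModule ℂ A]
  [One A] [MatrixOrderUnitSpace A]

open MatrixOrderUnitSpace

/-- The minor on the indices `i, j` has determinant `t ^ 2 - ‖z‖ ^ 2`, which is nonnegative. -/
lemma norm_le_of_posSemidef {z : ℂ} {t : ℝ} (ht : 0 ≤ t) {ι : Type*} [Fintype ι]
    {M : Matrix ι ι ℂ} (hM : M.PosSemidef) {i j : ι} (h₁ : M i i = t) (h₂ : M j j = t)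
    (h₃ : M i j = z) : ‖z‖ ≤ t := by
  have h := (hM.submatrix ![i, j]).det_nonneg
  have h₄ : M j i = star z := by rw [← h₃]; exact (hM.1.apply j i).symm
  rw [Matrix.det_fin_two] at h
  simp only [Matrix.submatrix_apply, Matrix.cons_val_zero, Matrix.cons_val_one, h₁, h₂, h₃,
    h₄] at h
  have e : z * star z = ((‖z‖ ^ 2 : ℝ) : ℂ) := by
    simpa using Complex.mul_conj' z
  rw [e, ← Complex.ofReal_mul, ← Complex.ofReal_sub, Complex.zero_le_real] at h
  nlinarith [norm_nonneg z]

lemma MatrixState.norm_apply_le {n : ℕ} (φ : MatrixState A n) (a : A) (i j : Fin n) :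
    ‖φ.1 a i j‖ ≤ ‖a‖ := by
  refine le_of_forall_gt_imp_ge_of_dense fun t ht => ?_
  have h := φ.2.2 2 _ (mem_pos_two_of_norm_lt ht)
  have h0 : 0 ≤ t := (norm_nonneg a).trans ht.le
  exact norm_le_of_posSemidef h0 h (i := (i, 0)) (j := (j, 1))
    (by simp [pairing_apply, φ.2.1]) (by simp [pairing_apply, φ.2.1]) (by simp [pairing_apply])

/-- A positive unital functional, as a matrix state of size one. -/
def stateOfPositive (f : A →ₗ[ℂ] ℂ) (h1 : f 1 = 1) (hstar : ∀ a, f (star a) = star (f a))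
    (hpos : ∀ a : A, !![a] ∈ pos 1 → 0 ≤ f a) : MatrixState A 1 :=
  ⟨{ toFun := fun a => !![f a]
     map_add' := fun a b => by ext i j; simp
     map_smul' := fun c a => by ext i j; simp }, by
      refine ⟨?_, fun r a ha => ?_⟩
      · ext i j
        fin_cases i; fin_cases j
        simp [h1]
      · refine Matrix.PosSemidef.of_dotProduct_mulVec_nonneg ?_ fun x => ?_
        · ext p q
          have := congrFun (congrFun (isSelfAdjoint_of_pos ha) p.2) q.2
          simp only [Matrix.conjTranspose_apply] at this
          simp [pairing_apply, ← this, hstar]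
        -- The quadratic form at `x` is `f` evaluated at the compression of `a` by the column `x`.
        · have h := compress (Matrix.of fun (k : Fin r) (_ : Fin 1) => x (0, k)) ha
          have h' := hpos (sandwich (Matrix.of fun (k : Fin r) (_ : Fin 1) => x (0, k))ᴴ a
            (Matrix.of fun (k : Fin r) (_ : Fin 1) => x (0, k)) 0 0) (by
              convert h using 1
              ext i j
              fin_cases i; fin_cases j
              rfl)
          convert h' using 1
          simp [sandwich_apply, dotProduct, Matrix.mulVec, Fintype.sum_prod_type, pairing_apply,
            Finset.mul_sum]
          refine Finset.sum_congr rfl fun k _ => Finset.sum_congr rfl fun l _ => ?_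
          ring⟩

variable (A) in
/-- The order unit as a self-adjoint element. -/
def saOne : selfAdjoint A := ⟨1, star_one⟩

lemma ne_zero_saOne {x : selfAdjoint A} (hx : x ≠ 0) : saOne A ≠ 0 := by
  intro h
  have h1 : (1 : A) = 0 := congrArg Subtype.val h
  apply hx
  obtain ⟨t, -, h₁, h₂⟩ := exists_add_sub_mem_pos (x : A) x.2
  have := proper h₁ (by
    convert h₂ using 1
    ext i j
    fin_cases i; fin_cases j
    simp [h1])
  have := congrFun (congrFun this 0) 0
  ext
  simpa [h1] using this

lemma norm_le_of_add_sub_mem_pos {x : A} (hx : star x = x) {t : ℝ} (ht : 0 ≤ t)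
    (h₁ : !![(t : ℂ) • (1 : A) + x] ∈ pos 1) (h₂ : !![(t : ℂ) • (1 : A) - x] ∈ pos 1) :
    ‖x‖ ≤ t := by
  refine norm_le_of_mem_pos_two ht ?_
  simpa [hx] using phase_mem_pos_two (c := 1) (by simp) h₁ h₂

variable (A) in
/-- The pairs `(x, y)` of self-adjoint elements with `-y ≤ x ≤ y`. -/
noncomputable def absCone : PointedCone ℝ (selfAdjoint A × selfAdjoint A) where
  carrier := {p | !![(p.2 : A) + p.1] ∈ pos 1 ∧ !![(p.2 : A) - p.1] ∈ pos 1}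
  zero_mem' := by
    have e : !![(0 : A)] = 0 := by ext i j; fin_cases i; fin_cases j; rfl
    simpa [e] using MatrixOrderUnitSpace.zero_mem (A := A) 1
  add_mem' := by
    rintro ⟨x, y⟩ ⟨x', y'⟩ ⟨h₁, h₂⟩ ⟨h₁', h₂'⟩
    refine ⟨?_, ?_⟩
    · convert add_mem h₁ h₁' using 1
      ext i j; fin_cases i; fin_cases j
      simp; abel
    · convert add_mem h₂ h₂' using 1
      ext i j; fin_cases i; fin_cases j
      simp; abel
  smul_mem' := by
    rintro ⟨t, ht⟩ ⟨x, y⟩ ⟨h₁, h₂⟩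
    refine ⟨?_, ?_⟩
    · convert smul_mem ht h₁ using 1
      ext i j; fin_cases i; fin_cases j
      simp
    · convert smul_mem ht h₂ using 1
      ext i j; fin_cases i; fin_cases j
      simp [smul_sub]

lemma mem_absCone {x y : selfAdjoint A} :
    (x, y) ∈ absCone A ↔ !![(y : A) + x] ∈ pos 1 ∧ !![(y : A) - x] ∈ pos 1 := Iff.rfl

/-- Jordan decomposition of a bounded real functional vanishing at the order unit. -/
lemma exists_positive_sub {u : selfAdjoint A →ₗ[ℝ] ℝ} (h1 : u (saOne A) = 0)
    (hne : saOne A ≠ 0) {C : ℝ} (hC : 0 < C) (hu : ∀ x, |u x| ≤ C * ‖(x : A)‖) :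
    ∃ g₁ g₂ : selfAdjoint A →ₗ[ℝ] ℝ, g₁ (saOne A) = C ∧ g₂ (saOne A) = C ∧
      (∀ x : selfAdjoint A, !![(x : A)] ∈ pos 1 → 0 ≤ g₁ x) ∧ (∀ x : selfAdjoint A, !![(x : A)] ∈ pos 1 → 0 ≤ g₂ x) ∧
      ∀ x, g₁ x - g₂ x = 2 * u x := by
  obtain ⟨s, hs⟩ := LinearMap.exists_leftInverse_of_injective
    (LinearMap.toSpanSingleton ℝ (selfAdjoint A) (saOne A))
    (LinearMap.ker_toSpanSingleton ℝ hne)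
  have hs1 : s (saOne A) = 1 := by
    have := LinearMap.congr_fun hs 1
    simpa using this
  -- Only the restriction to pairs `(x, t • 1)` matters, where `F` is `u x + C * t`; `s` serves just
  -- to read off the coordinate `t`.
  set F : selfAdjoint A × selfAdjoint A →ₗ[ℝ] ℝ :=
    u.comp (LinearMap.fst ℝ _ _) + C • s.comp (LinearMap.snd ℝ _ _) with hF
  set D : Submodule ℝ (selfAdjoint A × selfAdjoint A) :=
    (⊤ : Submodule ℝ _).prod (Submodule.span ℝ {saOne A}) with hD
  have hone : ((saOne A : selfAdjoint A) : A) = 1 := rfl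
  -- Riesz extension needs two facts: `F` is nonnegative on the cone, since `-t ≤ x ≤ t` gives `‖x‖
  -- ≤ t` and hence `|u x| ≤ C * t`; and adding a large multiple of the unit in the second
  -- coordinate moves any pair into the cone.
  obtain ⟨H, hH, hpos⟩ := riesz_extension (absCone A) ⟨D, F.domRestrict D⟩ (by
    rintro ⟨⟨x, y⟩, hxy⟩ hmem
    obtain ⟨t, rfl⟩ := Submodule.mem_span_singleton.1 hxy.2
    obtain ⟨h₁, h₂⟩ := mem_absCone.1 hmem
    have hval : ((t • saOne A : selfAdjoint A) : A) = (t : ℂ) • (1 : A) := by simp [hone]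
    rw [hval] at h₁ h₂
    change 0 ≤ u x + C • s (t • saOne A)
    rw [map_smul, hs1]
    have ht : 0 ≤ t := by
      -- Adding `t + x` and `t - x` shows that `2t` times the unit is positive; for `t < 0` this
      -- makes `-1` positive, so `1 = 0`.
      by_contra! ht
      have h₃ := smul_mem (t := (-t)⁻¹ / 2) (by have := inv_pos.2 (neg_pos.2 ht); positivity)
        (add_mem h₁ h₂)
      apply hne
      ext
      have h₄ : !![(1 : A)] = 0 := by
        refine proper one_mem_pos_one ?_
        convert h₃ using 1
        ext i j; fin_cases i; fin_cases j
        simp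
        have ht' : (t : ℂ) ≠ 0 := by exact_mod_cast ht.ne
        rw [← Complex.coe_smul t (1 : A), smul_smul, ← add_smul, ← neg_one_smul ℂ (1 : A)]
        congr 1
        field_simp
        ring
      exact congrFun (congrFun h₄ 0) 0
    have := norm_le_of_add_sub_mem_pos x.2 ht h₁ h₂
    have h₅ := hu x
    have h₆ := neg_abs_le (u x)
    have h₇ := mul_le_mul_of_nonneg_left this hC.le
    simp only [smul_eq_mul, mul_one]
    linarith) (by
    rintro ⟨x, y⟩
    obtain ⟨t, ht, h₁, -⟩ := exists_add_sub_mem_pos ((y + x : selfAdjoint A) : A) (y + x).2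
    obtain ⟨t', ht', h₁', -⟩ := exists_add_sub_mem_pos ((y - x : selfAdjoint A) : A) (y - x).2
    refine ⟨⟨(0, (t + t') • saOne A), trivial, Submodule.smul_mem _ _
      (Submodule.mem_span_singleton_self _)⟩, ?_⟩
    change ((0 + x, (t + t') • saOne A + y) : selfAdjoint A × selfAdjoint A) ∈ absCone A
    rw [mem_absCone]
    constructor
    · convert add_mem h₁ (smul_mem ht'.le one_mem_pos_one) using 1
      ext i j; fin_cases i; fin_cases j
      simp [hone]; module
    · convert add_mem h₁' (smul_mem ht.le one_mem_pos_one) using 1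
      ext i j; fin_cases i; fin_cases j
      simp [hone]; module)
  have hH' : ∀ (x : selfAdjoint A) (t : ℝ), H (x, t • saOne A) = u x + t * C := fun x t => by
    have := hH ⟨(x, t • saOne A), trivial, Submodule.smul_mem _ _
      (Submodule.mem_span_singleton_self _)⟩
    refine this.trans ?_
    change u x + C • s (t • saOne A) = _
    rw [map_smul, hs1]
    simp [mul_comm]
  have hzero : !![(0 : A)] ∈ pos 1 := by
    convert MatrixOrderUnitSpace.zero_mem (A := A) 1 using 1
    ext i j; fin_cases i; fin_cases j; rfl
  have htwo : ∀ x : selfAdjoint A, !![(x : A)] ∈ pos 1 → !![(x : A) + x] ∈ pos 1 := fun x hx => by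
    convert add_mem hx hx using 1
    ext i j; fin_cases i; fin_cases j; rfl
  -- The two parts are `x ↦ H (x, x)` and `x ↦ H (-x, x)`. For positive `x` both pairs lie in the
  -- cone, and the difference is `H (2x, 0)`, that is `2 * u x`.
  refine ⟨H.comp (LinearMap.prod LinearMap.id LinearMap.id),
    H.comp (LinearMap.prod (-LinearMap.id) LinearMap.id), ?_, ?_, fun x hx => ?_, fun x hx => ?_,
    fun x => ?_⟩
  · simpa [h1] using hH' (saOne A) 1
  · simpa [h1] using hH' (-saOne A) 1
  · exact hpos (x, x) (mem_absCone.2 ⟨htwo x hx, by simpa using hzero⟩)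
  · exact hpos (-x, x) (mem_absCone.2 ⟨by simpa using hzero, by simpa using htwo x hx⟩)
  · have e : ((x, x) : selfAdjoint A × selfAdjoint A) - (-x, x) = (2 : ℝ) • (x, (0 : ℝ) • saOne A) := by
      ext <;> simp [two_smul]
    change H (x, x) - H (-x, x) = _
    rw [← map_sub, e, map_smul, hH']
    simp

lemma exists_state_of_positive {g : selfAdjoint A →ₗ[ℝ] ℝ} {C : ℝ} (hC : 0 < C)
    (h1 : g (saOne A) = C) (hpos : ∀ x : selfAdjoint A, !![(x : A)] ∈ pos 1 → 0 ≤ g x) :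
    ∃ φ : MatrixState A 1, ∀ a, φ.1 a 0 0 = (C : ℂ)⁻¹ * complexify g a := by
  have hC' : (C : ℂ) ≠ 0 := by exact_mod_cast hC.ne'
  have hone : complexify g (1 : A) = C := by
    rw [← h1]
    exact complexify_coe g (saOne A)
  refine ⟨stateOfPositive ((C : ℂ)⁻¹ • complexify g) (by simp [hone, hC'])
    (fun a => by simp [complexify_star]) (fun a ha => ?_), fun a => by simp [stateOfPositive]⟩
  have hsa : star a = a := congrFun (congrFun (isSelfAdjoint_of_pos ha) 0) 0
  have e : complexify g a = g ⟨a, hsa⟩ := complexify_coe g ⟨a, hsa⟩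
  have := mul_nonneg (inv_nonneg.2 hC.le) (hpos ⟨a, hsa⟩ ha)
  simp only [LinearMap.smul_apply, e, smul_eq_mul]
  exact_mod_cast this

/-- A self-adjoint subspace that contains the order unit and separates the states is dense. -/
lemma dense_of_separates_states (W : Submodule ℂ A) (h1 : (1 : A) ∈ W)
    (hstar : ∀ a ∈ W, star a ∈ W)
    (hsep : ∀ φ ψ : MatrixState A 1, (∀ a ∈ W, φ.1 a 0 0 = ψ.1 a 0 0) → φ = ψ) :
    Dense (W : Set A) := by
  intro x
  by_contra hx
  obtain ⟨f, c, hfc, hcx⟩ := geometric_hahn_banach_closed_point (E := A) (x := x)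
    ((W.restrictScalars ℝ).convex.closure) isClosed_closure hx
  have hc : 0 < c := by simpa using hfc 0 (subset_closure W.zero_mem)
  have hf0 : ∀ w ∈ W, f w = 0 := by
    intro w hw
    by_contra hne
    have := hfc ((c / f w) • w) (subset_closure ((W.restrictScalars ℝ).smul_mem _ hw))
    rw [map_smul, smul_eq_mul, div_mul_cancel₀ _ hne] at this
    exact this.false
  have hI : ∀ w ∈ W, f (Complex.I • w) = 0 := fun w hw => hf0 _ (W.smul_mem _ hw)
  have hre : ∀ w ∈ W, (realPart w : A) ∈ W := fun w hw => by
    rw [realPart_apply_coe]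
    exact (W.restrictScalars ℝ).smul_mem _ (W.add_mem hw (hstar w hw))
  have him : ∀ w ∈ W, (imaginaryPart w : A) ∈ W := fun w hw => by
    rw [imaginaryPart_apply_coe]
    exact W.smul_mem _ ((W.restrictScalars ℝ).smul_mem _ (W.sub_mem hw (hstar w hw)))
  -- Since `u` vanishes at the unit, its Jordan parts have the same value `C` there and normalise to
  -- states; these agree on `W`, hence coincide, which forces `u = 0`.
  have key : ∀ u : selfAdjoint A →ₗ[ℝ] ℝ, ∀ C : ℝ, (∀ x, |u x| ≤ C * ‖(x : A)‖) →
      (∀ x : selfAdjoint A, (x : A) ∈ W → u x = 0) → u = 0 := by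
    intro u C hu huW
    by_contra hne
    obtain ⟨y, hy⟩ : ∃ y, u y ≠ 0 := by
      by_contra! h
      exact hne (LinearMap.ext h)
    have hC : 0 < C := by
      by_contra! hC
      have := (hu y).trans (mul_nonpos_of_nonpos_of_nonneg hC (norm_nonneg _))
      exact hy (abs_nonpos_iff.1 this)
    obtain ⟨g₁, g₂, hg₁, hg₂, hp₁, hp₂, hg⟩ := exists_positive_sub (huW (saOne A) h1)
      (ne_zero_saOne (x := y) (by rintro rfl; simp at hy)) hC hu
    obtain ⟨φ, hφ⟩ := exists_state_of_positive hC hg₁ hp₁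
    obtain ⟨ψ, hψ⟩ := exists_state_of_positive hC hg₂ hp₂
    have hg' : ∀ x : selfAdjoint A, (x : A) ∈ W → g₁ x = g₂ x := fun x hx => by
      have := hg x
      rw [huW x hx] at this
      linarith
    have hφψ := hsep φ ψ fun a ha => by
      rw [hφ, hψ, complexify_apply, complexify_apply, hg' _ (hre a ha), hg' _ (him a ha)]
    have h := hφ y
    rw [hφψ, hψ, complexify_coe, complexify_coe] at h
    have hC' : (C : ℂ)⁻¹ ≠ 0 := inv_ne_zero (by exact_mod_cast hC.ne')
    have h' : g₂ y = g₁ y := by exact_mod_cast mul_left_cancel₀ hC' h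
    have := hg y
    rw [h', sub_self] at this
    exact hy (by linarith)
  -- The separating `f` is only real-linear, so `f` and `x ↦ f (i x)` are restricted to the
  -- self-adjoint part separately.
  have k₁ := key (f.toLinearMap.comp (selfAdjoint.submodule ℝ A).subtype) ‖f‖
    (fun x => f.le_opNorm x) (fun x hx => hf0 _ hx)
  have k₂ := key ((f.toLinearMap.comp ((LinearMap.lsmul ℂ A Complex.I).restrictScalars ℝ)).comp
    (selfAdjoint.submodule ℝ A).subtype) ‖f‖
    (fun x => by
      have := f.le_opNorm (Complex.I • (x : A))
      rw [norm_smul, Complex.norm_I, one_mul] at this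
      exact this) (fun x hx => hI _ hx)
  have hfx : f x = 0 := by
    rw [← realPart_add_I_smul_imaginaryPart x, map_add]
    have e₁ := LinearMap.congr_fun k₁ (realPart x)
    have e₂ := LinearMap.congr_fun k₂ (imaginaryPart x)
    change f (realPart x : A) = 0 at e₁
    change f (Complex.I • (imaginaryPart x : A)) = 0 at e₂
    rw [e₁, e₂, add_zero]
  linarith

end States

/-! ### Algebra of compressions and direct sums. -/

section SandwichAlgebra

variable {V : Type*} [AddCommGroup V] [Module ℂ V] {m n p q : ℕ}

lemma sandwich_zero_right (α : Matrix (Fin m) (Fin p) ℂ) (v : Matrix (Fin p) (Fin q) V) :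
    sandwich α v (0 : Matrix (Fin q) (Fin n) ℂ) = 0 := by
  ext i j
  simp [sandwich_apply]

lemma sandwich_zero_left (v : Matrix (Fin p) (Fin q) V) (β : Matrix (Fin q) (Fin n) ℂ) :
    sandwich (0 : Matrix (Fin m) (Fin p) ℂ) v β = 0 := by
  ext i j
  simp [sandwich_apply]

lemma sandwich_zero (α : Matrix (Fin m) (Fin p) ℂ) (β : Matrix (Fin q) (Fin n) ℂ) :
    sandwich α (0 : Matrix (Fin p) (Fin q) V) β = 0 := by
  ext i j
  simp [sandwich_apply]

lemma sandwich_add (α : Matrix (Fin m) (Fin p) ℂ) (v w : Matrix (Fin p) (Fin q) V)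
    (β : Matrix (Fin q) (Fin n) ℂ) :
    sandwich α (v + w) β = sandwich α v β + sandwich α w β := by
  ext i j
  simp [sandwich_apply, Finset.sum_add_distrib]

lemma sandwich_smul (c : ℂ) (α : Matrix (Fin m) (Fin p) ℂ) (v : Matrix (Fin p) (Fin q) V)
    (β : Matrix (Fin q) (Fin n) ℂ) :
    sandwich α (c • v) β = c • sandwich α v β := by
  ext i j
  simp [sandwich_apply, Finset.smul_sum, smul_comm c]

lemma sandwich_smul_smul (c d : ℂ) (α : Matrix (Fin m) (Fin p) ℂ) (v : Matrix (Fin p) (Fin q) V)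
    (β : Matrix (Fin q) (Fin n) ℂ) :
    sandwich (c • α) v (d • β) = (c * d) • sandwich α v β := by
  ext i j
  simp only [sandwich_apply, Finset.smul_sum, smul_smul, Matrix.smul_apply, smul_eq_mul]
  refine Finset.sum_congr rfl fun k _ => Finset.sum_congr rfl fun l _ => ?_
  congr 1
  ring

lemma sandwich_one_one (v : Matrix (Fin m) (Fin n) V) : sandwich 1 v 1 = v := by
  ext i j
  simp [sandwich_apply, Matrix.one_apply, ite_smul, Finset.sum_ite_eq]

/-- The matrix with two blocks of columns `X` and `Y`. -/
def rowBlock (X : Matrix (Fin p) (Fin m) ℂ) (Y : Matrix (Fin p) (Fin n) ℂ) :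
    Matrix (Fin p) (Fin (m + n)) ℂ :=
  Matrix.of fun i => Fin.append (X i) (Y i)

lemma rowBlock_mul_conjTranspose (X : Matrix (Fin p) (Fin m) ℂ) (Y : Matrix (Fin p) (Fin n) ℂ) :
    rowBlock X Y * (rowBlock X Y)ᴴ = X * Xᴴ + Y * Yᴴ := by
  ext i j
  simp [-Fin.natAdd_eq_addNat, rowBlock, Matrix.mul_apply, Fin.sum_univ_add]

lemma sandwich_rowBlock (X : Matrix (Fin p) (Fin m) ℂ) (Y : Matrix (Fin p) (Fin n) ℂ)
    (v : Matrix (Fin m) (Fin m) V) (w : Matrix (Fin n) (Fin n) V) :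
    sandwich (rowBlock X Y) (directSum v w) (rowBlock X Y)ᴴ
      = sandwich X v Xᴴ + sandwich Y w Yᴴ := by
  ext i j
  simp [-Fin.natAdd_eq_addNat, rowBlock, sandwich_apply, Fin.sum_univ_add, directSum]

lemma norm_le_one_of_mul_conjTranspose {ι κ : Type*} [Fintype ι] [Fintype κ] [DecidableEq ι]
    [DecidableEq κ] [Nonempty ι] {α : Matrix ι κ ℂ} (h : α * αᴴ = 1) : ‖α‖ ≤ 1 := by
  have h₁ := Matrix.l2_opNorm_conjTranspose_mul_self αᴴ
  rw [Matrix.conjTranspose_conjTranspose, h, Matrix.l2_opNorm_conjTranspose, norm_one] at h₁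
  nlinarith [norm_nonneg α]

lemma norm_le_one_of_conjTranspose_mul {ι κ : Type*} [Fintype ι] [Fintype κ] [DecidableEq ι]
    [DecidableEq κ] [Nonempty κ] {α : Matrix ι κ ℂ} (h : αᴴ * α = 1) : ‖α‖ ≤ 1 := by
  rw [← Matrix.l2_opNorm_conjTranspose]
  exact norm_le_one_of_mul_conjTranspose (by rwa [Matrix.conjTranspose_conjTranspose])

lemma sandwich_rowBlock_one_zero (v : Matrix (Fin m) (Fin m) V) (w : Matrix (Fin n) (Fin n) V) :
    sandwich (rowBlock 1 0) (directSum v w) (rowBlock 1 0)ᴴ = v := by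
  rw [sandwich_rowBlock, sandwich_zero_left, Matrix.conjTranspose_one, sandwich_one_one, add_zero]

lemma sandwich_rowBlock_zero_one (v : Matrix (Fin m) (Fin m) V) (w : Matrix (Fin n) (Fin n) V) :
    sandwich (rowBlock 0 1) (directSum v w) (rowBlock 0 1)ᴴ = w := by
  rw [sandwich_rowBlock, sandwich_zero_left, Matrix.conjTranspose_one, sandwich_one_one, zero_add]

lemma directSum_smul_add {m n : ℕ} (c : ℂ) (v v' : Matrix (Fin m) (Fin m) V)
    (w w' : Matrix (Fin n) (Fin n) V) :
    directSum (c • v + v') (c • w + w') = c • directSum v w + directSum v' w' := by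
  refine ext_castAdd_natAdd ?_ ?_ ?_ ?_ <;> simp [-Fin.natAdd_eq_addNat, directSum]

end SandwichAlgebra

/-! ### Scalar matrices over the order unit space. -/

section ScalarMatrix

variable {A : Type*} [NormedAddCommGroup A] [NormedSpace ℂ A] [One A]

variable (A) in
/-- The scalar matrices in `M_n(A)`. -/
def scalarMatrix (n : ℕ) : Matrix (Fin n) (Fin n) ℂ →ₗ[ℂ] Matrix (Fin n) (Fin n) A where
  toFun c := c.map fun z => z • (1 : A)
  map_add' c d := by ext i j; simp [add_smul]
  map_smul' z c := by ext i j; simp [smul_smul]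

@[simp]
lemma scalarMatrix_apply {n : ℕ} (c : Matrix (Fin n) (Fin n) ℂ) (i j : Fin n) :
    scalarMatrix A n c i j = c i j • (1 : A) := rfl

lemma sandwich_scalarMatrix {m n : ℕ} (α : Matrix (Fin n) (Fin m) ℂ)
    (c : Matrix (Fin m) (Fin m) ℂ) (β : Matrix (Fin m) (Fin n) ℂ) :
    sandwich α (scalarMatrix A m c) β = scalarMatrix A n (α * c * β) := by
  ext i j
  simp only [sandwich_apply, scalarMatrix_apply, smul_smul, ← Finset.sum_smul, Matrix.mul_apply,
    Finset.sum_mul]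
  rw [Finset.sum_comm]
  congr 1
  refine Finset.sum_congr rfl fun k _ => Finset.sum_congr rfl fun l _ => ?_
  ring

lemma directSum_scalarMatrix {m n : ℕ} (c : Matrix (Fin m) (Fin m) ℂ)
    (d : Matrix (Fin n) (Fin n) ℂ) :
    directSum (scalarMatrix A m c) (scalarMatrix A n d) = scalarMatrix A (m + n) (directSum c d) := by
  refine ext_castAdd_natAdd ?_ ?_ ?_ ?_ <;> simp [-Fin.natAdd_eq_addNat, directSum]

lemma isClosed_range_scalarMatrix (n : ℕ) :
    IsClosed (Set.range (scalarMatrix A n)) := by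
  rw [← LinearMap.coe_range]
  exact Submodule.closed_of_finiteDimensional _

end ScalarMatrix

/-! ### The gauge of a matrix metric set. -/

section Gauge

variable {A : Type*} [NormedAddCommGroup A] [NormedSpace ℂ A] [StarAddMonoid A] [StarModule ℂ A]
  [One A] [MatrixOrderUnitSpace A]

lemma conjTranspose_scalarMatrix {n : ℕ} (c : Matrix (Fin n) (Fin n) ℂ) :
    (scalarMatrix A n c)ᴴ = scalarMatrix A n cᴴ := by
  ext i j
  simp [MatrixOrderUnitSpace.star_one]

lemma IsMatrixMetricSet.isCompact' {K : ∀ n : ℕ, Set (Matrix (Fin n) (Fin n) A)}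
    (hK : IsMatrixMetricSet K) {n : ℕ} (hn : 0 < n) : IsCompact (K n) := by
  have := hK.isCompact n hn
  rwa [normTopology_eq] at this

/-- The axioms allow empty levels, whereas a gauge ball must contain `0`. A nonempty level already
forces `0` into every level, by compressing with zero matrices, so the mixed direct sums stay
inside. -/
lemma IsMatrixMetricSet.insert_zero {K : ∀ n : ℕ, Set (Matrix (Fin n) (Fin n) A)}
    (hK : IsMatrixMetricSet K) : IsMatrixMetricSet fun n => insert 0 (K n) where
  isCompact n hn := by
    rw [normTopology_eq]
    exact (hK.isCompact' hn).insert 0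
  star_mem n hn := by
    rintro a (rfl | ha)
    · exact Or.inl Matrix.conjTranspose_zero
    · exact Or.inr (hK.star_mem n hn a ha)
  directSum_mem m n hm hn := by
    have h0 : ∀ {p q : ℕ}, 0 < p → 0 < q → ∀ a ∈ K p, (0 : Matrix (Fin q) (Fin q) A) ∈ K q :=
      fun {p q} hp hq a ha => by
        simpa [sandwich_zero_left] using
          hK.sandwich_mem p q hp hq 0 0 (by simp) (by simp) a ha
    rintro a (rfl | ha) b (rfl | hb)
    · left
      refine ext_castAdd_natAdd ?_ ?_ ?_ ?_ <;> simp [-Fin.natAdd_eq_addNat, directSum]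
    · exact Or.inr (hK.directSum_mem m n hm hn 0 (h0 hn hm b hb) b hb)
    · exact Or.inr (hK.directSum_mem m n hm hn a ha 0 (h0 hm hn a ha))
    · exact Or.inr (hK.directSum_mem m n hm hn a ha b hb)
  sandwich_mem m n hm hn α β hα hβ := by
    rintro a (rfl | ha)
    · exact Or.inl (sandwich_zero α β)
    · exact Or.inr (hK.sandwich_mem m n hm hn α β hα hβ a ha)
  separates n hn φ ψ h := by
    obtain ⟨r, hr, a, ha, hne⟩ := hK.separates n hn φ ψ h
    exact ⟨r, hr, a, Or.inr ha, hne⟩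

lemma stateDist_insert_zero (K : ∀ n : ℕ, Set (Matrix (Fin n) (Fin n) A)) (n : ℕ)
    (φ ψ : MatrixState A n) :
    stateDist (fun n => insert 0 (K n)) n φ ψ = stateDist K n φ ψ := by
  have e : ∀ (r : ℕ) (φ : MatrixState A n), pairing φ.1 (0 : Matrix (Fin r) (Fin r) A) = 0 :=
    fun r φ => by ext p q; simp [pairing_apply]
  refine iSup_congr fun r => iSup_congr fun _ => ?_
  rw [iSup_insert, e, e]
  simp

namespace IsMatrixMetricSet

variable {K : ∀ n : ℕ, Set (Matrix (Fin n) (Fin n) A)}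

lemma exists_smul_eq_sandwich (hK : IsMatrixMetricSet K) {m n : ℕ} (hm : 0 < m) (hn : 0 < n)
    (α : Matrix (Fin n) (Fin m) ℂ) (β : Matrix (Fin m) (Fin n) ℂ)
    {a : Matrix (Fin m) (Fin m) A} (ha : a ∈ K m) :
    ∃ k ∈ K n, sandwich α a β = ((‖α‖ * ‖β‖ : ℝ) : ℂ) • k := by
  have hnorm : ∀ {p q : ℕ} (γ : Matrix (Fin p) (Fin q) ℂ),
      ‖((‖γ‖⁻¹ : ℝ) : ℂ) • γ‖ ≤ 1 ∧ γ = (‖γ‖ : ℂ) • ((‖γ‖⁻¹ : ℝ) : ℂ) • γ := fun γ => by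
    rcases eq_or_ne γ 0 with rfl | h
    · simp
    · have h' : ‖γ‖ ≠ 0 := norm_ne_zero_iff.2 h
      refine ⟨by rw [norm_smul]; simp [h'], ?_⟩
      rw [smul_smul, ← Complex.ofReal_mul, mul_inv_cancel₀ h', Complex.ofReal_one, one_smul]
  refine ⟨_, hK.sandwich_mem m n hm hn _ _ (hnorm α).1 (hnorm β).1 a ha, ?_⟩
  conv_lhs => rw [(hnorm α).2, (hnorm β).2]
  rw [sandwich_smul_smul, Complex.ofReal_mul]

lemma smul_mem (hK : IsMatrixMetricSet K) {n : ℕ} (hn : 0 < n) {z : ℂ} (hz : ‖z‖ ≤ 1)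
    {a : Matrix (Fin n) (Fin n) A} (ha : a ∈ K n) : z • a ∈ K n := by
  have : Nonempty (Fin n) := ⟨⟨0, hn⟩⟩
  have h := hK.sandwich_mem n n hn hn (z • 1) ((1 : ℂ) • 1)
    (by rw [norm_smul, norm_one, mul_one]; exact hz) (by simp) a ha
  rwa [sandwich_smul_smul, sandwich_one_one, mul_one] at h

/-- The row `(√s, √t)` of scalar blocks is a coisometry, and compressing `a ⊕ b` by it gives the
convex combination. -/
lemma convexCombo_mem (hK : IsMatrixMetricSet K) {n : ℕ} (hn : 0 < n) {s t : ℝ} (hs : 0 ≤ s)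
    (ht : 0 ≤ t) (hst : s + t = 1) {a b : Matrix (Fin n) (Fin n) A} (ha : a ∈ K n)
    (hb : b ∈ K n) : (s : ℂ) • a + (t : ℂ) • b ∈ K n := by
  have : Nonempty (Fin n) := ⟨⟨0, hn⟩⟩
  have hsq : ∀ {x : ℝ}, 0 ≤ x → ((√x : ℝ) : ℂ) * (√x : ℝ) = x := fun hx => by
    rw [← Complex.ofReal_mul, Real.mul_self_sqrt hx]
  set α : Matrix (Fin n) (Fin (n + n)) ℂ :=
    rowBlock (((√s : ℝ) : ℂ) • 1) (((√t : ℝ) : ℂ) • 1) with hα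
  have h1 : α * αᴴ = 1 := by
    rw [hα, rowBlock_mul_conjTranspose]
    simp only [Matrix.conjTranspose_smul, Matrix.conjTranspose_one, Complex.star_def,
      Complex.conj_ofReal, smul_mul_smul_comm, mul_one, hsq hs, hsq ht]
    rw [← add_smul, ← Complex.ofReal_add, hst, Complex.ofReal_one, one_smul]
  have hα1 : ‖α‖ ≤ 1 := norm_le_one_of_mul_conjTranspose h1
  have h := hK.sandwich_mem (n + n) n (by omega) hn α αᴴ hα1
    (by rwa [Matrix.l2_opNorm_conjTranspose]) _ (hK.directSum_mem n n hn hn a ha b hb)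
  rw [hα, sandwich_rowBlock] at h
  simpa only [Matrix.conjTranspose_smul, Matrix.conjTranspose_one, Complex.star_def,
      Complex.conj_ofReal, sandwich_smul_smul, sandwich_one_one, hsq hs, hsq ht] using h

lemma exists_smul_add_smul (hK : IsMatrixMetricSet K) {n : ℕ} (hn : 0 < n) (s t : NNReal)
    {a b : Matrix (Fin n) (Fin n) A} (ha : a ∈ K n) (hb : b ∈ K n) :
    ∃ k ∈ K n, ((s : ℝ) : ℂ) • a + ((t : ℝ) : ℂ) • b = (((s + t : NNReal) : ℝ) : ℂ) • k := by
  rcases eq_or_ne (s + t) 0 with h | h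
  · obtain ⟨rfl, rfl⟩ := add_eq_zero.1 h
    exact ⟨a, ha, by simp⟩
  · have h' : (s : ℝ) + t ≠ 0 := by exact_mod_cast h
    refine ⟨_, hK.convexCombo_mem hn (s := s / (s + t)) (t := t / (s + t)) (by positivity)
      (by positivity) (by field_simp) ha hb, ?_⟩
    have h'' : (s : ℂ) + t ≠ 0 := by exact_mod_cast h'
    rw [smul_add, smul_smul, smul_smul]
    congr 2 <;> push_cast <;> field_simp

end IsMatrixMetricSet

/-- The dilation by `t` of a set of matrices, translated by all scalar matrices. -/
def scalarDilate (K : ∀ n : ℕ, Set (Matrix (Fin n) (Fin n) A)) (n : ℕ) (t : NNReal) :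
    Set (Matrix (Fin n) (Fin n) A) :=
  {v | ∃ k ∈ K n, ∃ c, v = ((t : ℝ) : ℂ) • k + scalarMatrix A n c}

/-- The gauge whose unit ball consists of the sums of elements of `K` and scalar matrices. -/
noncomputable def gaugeOf (K : ∀ n : ℕ, Set (Matrix (Fin n) (Fin n) A)) (n : ℕ)
    (v : Matrix (Fin n) (Fin n) A) : ℝ≥0∞ :=
  ⨅ (t : NNReal) (_ : v ∈ scalarDilate K n t), (t : ℝ≥0∞)

variable {K : ∀ n : ℕ, Set (Matrix (Fin n) (Fin n) A)}

lemma scalarDilate_mono (hK : IsMatrixMetricSet K) {n : ℕ} (hn : 0 < n) {s t : NNReal}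
    (hst : s ≤ t) : scalarDilate K n s ⊆ scalarDilate K n t := by
  rintro v ⟨k, hk, c, rfl⟩
  rcases eq_or_ne t 0 with rfl | ht
  · obtain rfl : s = 0 := le_antisymm hst zero_le
    exact ⟨k, hk, c, rfl⟩
  · refine ⟨(((s / t : NNReal) : ℝ) : ℂ) • k, hK.smul_mem hn ?_ hk, c, ?_⟩
    · rw [Complex.norm_real, Real.norm_eq_abs, NNReal.abs_eq]
      exact_mod_cast div_le_one_of_le₀ hst zero_le
    · rw [smul_smul, ← Complex.ofReal_mul, ← NNReal.coe_mul, mul_div_cancel₀ _ ht]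

/-- Membership means that `v - t k` is scalar for some `k`; this closed condition is projected along
the compact `K n`. Closedness jointly in `(t, v)` yields both attainment and semicontinuity. -/
lemma isClosed_setOf_mem_scalarDilate (hK : IsMatrixMetricSet K) {n : ℕ} (hn : 0 < n) :
    IsClosed {p : NNReal × Matrix (Fin n) (Fin n) A | p.2 ∈ scalarDilate K n p.1} := by
  have : CompactSpace (K n) := isCompact_iff_compactSpace.1 (hK.isCompact' hn)
  have hf : Continuous fun q : (NNReal × Matrix (Fin n) (Fin n) A) × K n =>
      q.1.2 - ((q.1.1 : ℝ) : ℂ) • (q.2 : Matrix (Fin n) (Fin n) A) :=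
    (continuous_snd.comp continuous_fst).sub
      ((Complex.continuous_ofReal.comp (NNReal.continuous_coe.comp
        (continuous_fst.comp continuous_fst))).smul (continuous_subtype_val.comp continuous_snd))
  have h := isClosedMap_fst_of_compactSpace _ ((isClosed_range_scalarMatrix (A := A) n).preimage hf)
  convert h using 1
  ext ⟨t, v⟩
  constructor
  · rintro ⟨k, hk, c, hv⟩
    exact ⟨((t, v), ⟨k, hk⟩), ⟨c, by simp [show v = _ from hv]⟩, rfl⟩
  · rintro ⟨⟨⟨t', v'⟩, k⟩, ⟨c, hc⟩, h⟩
    obtain ⟨rfl, rfl⟩ := Prod.mk.inj h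
    exact ⟨k, k.2, c, by simp [hc]⟩

/-- The infimum is attained: `v` lies in every dilate with factor above `t` by monotonicity, and
closedness in the factor gives `t` itself. -/
lemma gaugeOf_le_iff (hK : IsMatrixMetricSet K) {n : ℕ} (hn : 0 < n)
    {v : Matrix (Fin n) (Fin n) A} {t : NNReal} :
    gaugeOf K n v ≤ t ↔ v ∈ scalarDilate K n t := by
  refine ⟨fun h => ?_, fun h => iInf₂_le t h⟩
  have hmem : ∀ s : NNReal, t < s → v ∈ scalarDilate K n s := fun s hs => by
    have hlt : gaugeOf K n v < s := h.trans_lt (by exact_mod_cast hs)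
    simp only [gaugeOf, iInf_lt_iff] at hlt
    obtain ⟨r, hr, hrs⟩ := hlt
    exact scalarDilate_mono hK hn (by exact_mod_cast hrs.le) hr
  have hcl := (isClosed_setOf_mem_scalarDilate hK hn).preimage
    (Continuous.prodMk_left v)
  have : t ∈ closure (Set.Ioi t) := by rw [closure_Ioi]; exact Set.mem_Ici.2 le_rfl
  exact hcl.closure_subset_iff.2 (fun s hs => hmem s hs) this

lemma unitBall_gaugeOf (hK : IsMatrixMetricSet K) {n : ℕ} (hn : 0 < n) :
    unitBall (gaugeOf K) n = scalarDilate K n 1 := by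
  ext v
  exact gaugeOf_le_iff (t := 1) hK hn

lemma lowerSemicontinuous_gaugeOf (hK : IsMatrixMetricSet K) {n : ℕ} (hn : 0 < n) :
    LowerSemicontinuous (gaugeOf K n) := by
  rw [lowerSemicontinuous_iff_isClosed_preimage]
  intro y
  induction y with
  | top => simp
  | coe t =>
    convert (isClosed_setOf_mem_scalarDilate hK hn).preimage (Continuous.prodMk_right t) using 1
    ext v
    exact gaugeOf_le_iff hK hn

lemma gaugeOf_sandwich_le (hK : IsMatrixMetricSet K) (h0 : ∀ n, 0 < n → 0 ∈ K n) {m n : ℕ}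
    (hm : 0 < m) (hn : 0 < n) (α : Matrix (Fin n) (Fin m) ℂ) (v : Matrix (Fin m) (Fin m) A)
    (β : Matrix (Fin m) (Fin n) ℂ) :
    gaugeOf K n (sandwich α v β) ≤ ‖α‖ₑ * gaugeOf K m v * ‖β‖ₑ := by
  have hz : gaugeOf K n 0 = 0 := by
    refine le_antisymm ?_ zero_le
    exact (gaugeOf_le_iff (t := 0) hK hn).2 ⟨0, h0 n hn, 0, by simp⟩
  -- With `0 * ∞ = 0`, a vanishing coefficient needs the gauge of `0` to be `0`; otherwise an
  -- infinite gauge makes the right side infinite.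
  rcases eq_or_ne α 0 with rfl | hα
  · simp [sandwich_zero_left, hz]
  rcases eq_or_ne β 0 with rfl | hβ
  · simp [sandwich_zero_right, hz]
  induction h : gaugeOf K m v with
  | top => simp [ENNReal.mul_top, ENNReal.top_mul, hα, hβ]
  | coe t =>
    obtain ⟨k, hk, c, rfl⟩ := (gaugeOf_le_iff hK hm).1 h.le
    have e : ‖α‖ₑ * (t : ℝ≥0∞) * ‖β‖ₑ = ((‖α‖₊ * t * ‖β‖₊ : NNReal) : ℝ≥0∞) := by
      simp [enorm]
    rw [e, gaugeOf_le_iff hK hn]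
    obtain ⟨k', hk', e'⟩ := hK.exists_smul_eq_sandwich hm hn α β hk
    refine ⟨k', hk', α * c * β, ?_⟩
    rw [sandwich_add, sandwich_smul, sandwich_scalarMatrix, e', smul_smul]
    congr 2
    push_cast
    ring

lemma isMatrixGauge_gaugeOf (hK : IsMatrixMetricSet K) (h0 : ∀ n, 0 < n → 0 ∈ K n) :
    IsMatrixGauge (gaugeOf K) where
  add_le n hn v w := by
    induction h : gaugeOf K n v with
    | top => simp
    | coe s =>
      induction h' : gaugeOf K n w with
      | top => simp
      | coe t =>
        obtain ⟨k, hk, c, rfl⟩ := (gaugeOf_le_iff hK hn).1 h.le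
        obtain ⟨l, hl, d, rfl⟩ := (gaugeOf_le_iff hK hn).1 h'.le
        obtain ⟨k', hk', e⟩ := hK.exists_smul_add_smul hn s t hk hl
        rw [← ENNReal.coe_add, gaugeOf_le_iff hK hn]
        refine ⟨k', hk', c + d, ?_⟩
        rw [map_add, ← e]
        abel
  smul_eq n hn c v := by
    have : Nonempty (Fin n) := ⟨⟨0, hn⟩⟩
    have hle : ∀ (c : ℂ) v, gaugeOf K n (c • v) ≤ ‖c‖ₑ * gaugeOf K n v := fun c v => by
      have h := gaugeOf_sandwich_le hK h0 hn hn (c • 1) v ((1 : ℂ) • 1)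
      rw [sandwich_smul_smul, sandwich_one_one, mul_one, one_smul, enorm_smul] at h
      have h1 : ‖(1 : Matrix (Fin n) (Fin n) ℂ)‖ₑ = 1 := by simp [enorm]
      rwa [h1, mul_one, mul_one] at h
    refine le_antisymm (hle c v) ?_
    rcases eq_or_ne c 0 with rfl | hc
    · simp
    · have h := hle c⁻¹ (c • v)
      rw [smul_smul, inv_mul_cancel₀ hc, one_smul] at h
      refine (mul_le_mul_right h _).trans_eq ?_
      rw [← mul_assoc, ← enorm_mul, mul_inv_cancel₀ hc, enorm_one, one_mul]
  directSum_eq m n hm hn v w := by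
    have : Nonempty (Fin n) := ⟨⟨0, hn⟩⟩
    have : Nonempty (Fin m) := ⟨⟨0, hm⟩⟩
    -- Coisometries do not increase the gauge; the two coordinate ones recover the summands and give
    -- the lower bound.
    have hcontr : ∀ {p : ℕ}, 0 < p → ∀ α : Matrix (Fin p) (Fin (m + n)) ℂ, α * αᴴ = 1 →
        gaugeOf K p (sandwich α (directSum v w) αᴴ) ≤ gaugeOf K (m + n) (directSum v w) :=
      fun {p} hp α hα => by
        have : Nonempty (Fin p) := ⟨⟨0, hp⟩⟩
        have h1 : ‖α‖ₑ ≤ 1 := by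
          have := norm_le_one_of_mul_conjTranspose hα
          rw [← ofReal_norm]
          exact ENNReal.ofReal_le_one.2 this
        have h2 : ‖αᴴ‖ₑ ≤ 1 := by
          rwa [← ofReal_norm, Matrix.l2_opNorm_conjTranspose, ofReal_norm]
        calc _ ≤ _ := gaugeOf_sandwich_le hK h0 (by omega) hp _ _ _
          _ ≤ 1 * gaugeOf K (m + n) (directSum v w) * 1 := by gcongr
          _ = _ := by simp
    refine le_antisymm ?_ (max_le ?_ ?_)
    · induction h : max (gaugeOf K m v) (gaugeOf K n w) with
      | top => simp
      | coe t =>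
        obtain ⟨k, hk, c, rfl⟩ := (gaugeOf_le_iff hK hm).1 ((le_max_left _ _).trans h.le)
        obtain ⟨l, hl, d, rfl⟩ := (gaugeOf_le_iff hK hn).1 ((le_max_right _ _).trans h.le)
        rw [gaugeOf_le_iff hK (by omega)]
        exact ⟨_, hK.directSum_mem m n hm hn k hk l hl, directSum c d, by
          rw [directSum_smul_add, directSum_scalarMatrix]⟩
    · have := hcontr hm (rowBlock 1 0) (by simp [rowBlock_mul_conjTranspose])
      rwa [sandwich_rowBlock_one_zero] at this
    · have := hcontr hn (rowBlock 0 1) (by simp [rowBlock_mul_conjTranspose])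
      rwa [sandwich_rowBlock_zero_one] at this
  sandwich_le m n hm hn α v β := gaugeOf_sandwich_le hK h0 hm hn α v β

lemma gaugeOf_eq_zero_iff (hK : IsMatrixMetricSet K) (h0 : ∀ n, 0 < n → 0 ∈ K n) {n : ℕ}
    (hn : 0 < n) (v : Matrix (Fin n) (Fin n) A) :
    gaugeOf K n v = 0 ↔ ∃ c : Matrix (Fin n) (Fin n) ℂ, v = c.map fun z => z • (1 : A) := by
  rw [← nonpos_iff_eq_zero, ← ENNReal.coe_zero, gaugeOf_le_iff hK hn]
  constructor
  · rintro ⟨k, -, c, rfl⟩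
    exact ⟨c, by simp; rfl⟩
  · rintro ⟨c, rfl⟩
    exact ⟨0, h0 n hn, c, by simp; rfl⟩

lemma gaugeOf_conjTranspose (hK : IsMatrixMetricSet K) {n : ℕ} (hn : 0 < n)
    (v : Matrix (Fin n) (Fin n) A) : gaugeOf K n vᴴ = gaugeOf K n v := by
  have hle : ∀ v, gaugeOf K n vᴴ ≤ gaugeOf K n v := fun v => by
    induction h : gaugeOf K n v with
    | top => simp
    | coe t =>
      obtain ⟨k, hk, c, rfl⟩ := (gaugeOf_le_iff hK hn).1 h.le
      rw [gaugeOf_le_iff hK hn]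
      refine ⟨kᴴ, hK.star_mem n hn k hk, cᴴ, ?_⟩
      rw [Matrix.conjTranspose_add, conjTranspose_scalarMatrix, Matrix.conjTranspose_smul]
      simp
  refine le_antisymm (hle v) ?_
  simpa using hle vᴴ

lemma stateDist_unitBall_gaugeOf (hK : IsMatrixMetricSet K) (n : ℕ) (φ ψ : MatrixState A n) :
    stateDist (unitBall (gaugeOf K)) n φ ψ = stateDist K n φ ψ := by
  have e : ∀ (r : ℕ) (k : Matrix (Fin r) (Fin r) A) (c : Matrix (Fin r) (Fin r) ℂ),
      pairing φ.1 (k + scalarMatrix A r c) - pairing ψ.1 (k + scalarMatrix A r c)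
        = pairing φ.1 k - pairing ψ.1 k := fun r k c => by
    ext p q
    simp [pairing_apply, φ.2.1, ψ.2.1]
  refine iSup_congr fun r => iSup_congr fun hr => ?_
  rw [unitBall_gaugeOf hK hr]
  refine le_antisymm (iSup₂_le ?_) (iSup₂_le fun a ha => ?_)
  · rintro a ⟨k, hk, c, rfl⟩
    rw [NNReal.coe_one, Complex.ofReal_one, one_smul, e]
    exact le_iSup₂_of_le k hk le_rfl
  · exact le_iSup₂_of_le a ⟨a, ha, 0, by simp⟩ le_rfl

end Gauge

/-! ### Operator norms of scalar matrices. -/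

section MatrixNorm

lemma norm_matrix_one_one (M : Matrix (Fin 1) (Fin 1) ℂ) : ‖M‖ = ‖M 0 0‖ := by
  have e : M = Matrix.diagonal fun _ => M 0 0 := by
    ext i j
    fin_cases i; fin_cases j
    rfl
  conv_lhs => rw [e, Matrix.l2_opNorm_diagonal]
  rw [pi_norm_const]

lemma norm_replicateCol {r : ℕ} (y : EuclideanSpace ℂ (Fin r)) :
    ‖(Matrix.of fun i (_ : Fin 1) => y i : Matrix (Fin r) (Fin 1) ℂ)‖ = ‖y‖ := by
  have h := Matrix.l2_opNorm_conjTranspose_mul_self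
    (Matrix.of fun i (_ : Fin 1) => y i : Matrix (Fin r) (Fin 1) ℂ)
  rw [norm_matrix_one_one] at h
  have e : ((Matrix.of fun i (_ : Fin 1) => y i : Matrix (Fin r) (Fin 1) ℂ)ᴴ *
      Matrix.of fun i (_ : Fin 1) => y i) 0 0 = ((‖y‖ ^ 2 : ℝ) : ℂ) := by
    rw [EuclideanSpace.norm_sq_eq]
    simp [Matrix.mul_apply, Complex.conj_mul']
  rw [e, Complex.norm_real, Real.norm_of_nonneg (by positivity), ← sq] at h
  exact ((sq_eq_sq₀ (norm_nonneg _) (norm_nonneg _)).1 h).symm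

/-- Vectors are replaced by one-column matrices so that the test can be run through `sandwich`. -/
lemma norm_le_of_mul_col {m r : ℕ} {M : Matrix (Fin m) (Fin r) ℂ} {C : ℝ} (hC : 0 ≤ C)
    (h : ∀ Y : Matrix (Fin r) (Fin 1) ℂ, ‖M * Y‖ ≤ C * ‖Y‖) : ‖M‖ ≤ C := by
  rw [Matrix.l2_opNorm_def]
  refine ContinuousLinearMap.opNorm_le_bound _ hC fun y => ?_
  have h' := h (Matrix.of fun i _ => y i)
  rw [norm_replicateCol] at h'
  refine le_trans (le_of_eq ?_) h'
  rw [← norm_replicateCol]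
  congr 1

lemma norm_apply_le_norm {ι κ : Type*} [Fintype ι] [Fintype κ] [DecidableEq κ]
    (M : Matrix ι κ ℂ) (i : ι) (j : κ) : ‖M i j‖ ≤ ‖M‖ := by
  have h := M.l2_opNorm_mulVec (EuclideanSpace.single j 1)
  rw [PiLp.norm_single, norm_one, mul_one] at h
  refine le_trans (le_of_eq ?_) ((PiLp.norm_apply_le _ i).trans h)
  simp

/-- The operator norm of a block matrix is at most the sum of the norms of its blocks. -/
lemma norm_le_sum_norm_blocks {n r : ℕ} (hr : 0 < r)
    (M : Matrix (Fin n × Fin r) (Fin n × Fin r) ℂ) :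
    ‖M‖ ≤ ∑ i, ∑ j, ‖(Matrix.of fun k l => M (i, k) (j, l) : Matrix (Fin r) (Fin r) ℂ)‖ := by
  have : Nonempty (Fin r) := ⟨⟨0, hr⟩⟩
  -- `J i` is the isometry onto the `i`-th summand, so `M` is the sum of its blocks placed by the `J
  -- i`.
  set J : Fin n → Matrix (Fin n × Fin r) (Fin r) ℂ :=
    fun i => Matrix.of fun p l => if p = (i, l) then 1 else 0 with hJ
  have hJ1 : ∀ i, ‖J i‖ ≤ 1 := fun i => norm_le_one_of_conjTranspose_mul (by
    ext k l
    simp [hJ, Matrix.mul_apply, Matrix.one_apply, eq_comm])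
  have e : M = ∑ i, ∑ j, J i * (Matrix.of fun k l => M (i, k) (j, l)) * (J j)ᴴ := by
    ext ⟨i, k⟩ ⟨j, l⟩
    simp only [Matrix.sum_apply]
    rw [Finset.sum_eq_single i, Finset.sum_eq_single j]
    · simp [hJ, Matrix.mul_apply]
    · intro b _ hb
      simp [hJ, Matrix.mul_apply, hb.symm]
    · simp
    · intro b _ hb
      simp [hJ, Matrix.mul_apply, hb.symm]
    · simp
  conv_lhs => rw [e]
  refine (norm_sum_le _ _).trans (Finset.sum_le_sum fun i _ => (norm_sum_le _ _).trans
    (Finset.sum_le_sum fun j _ => ?_))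
  set B : Matrix (Fin r) (Fin r) ℂ := Matrix.of fun k l => M (i, k) (j, l)
  calc ‖J i * B * (J j)ᴴ‖ ≤ ‖J i * B‖ * ‖(J j)ᴴ‖ := Matrix.l2_opNorm_mul _ _
    _ ≤ (‖J i‖ * ‖B‖) * ‖(J j)ᴴ‖ := by gcongr; exact Matrix.l2_opNorm_mul _ _
    _ ≤ (1 * ‖B‖) * 1 := by
      gcongr
      · exact hJ1 i
      · rw [Matrix.l2_opNorm_conjTranspose]; exact hJ1 j
    _ = ‖B‖ := by ring

end MatrixNorm

/-! ### The distance induces the BW-topology. -/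

section Topology

variable {A : Type*} [NormedAddCommGroup A] [NormedSpace ℂ A] [StarAddMonoid A] [StarModule ℂ A]
  [One A] [MatrixOrderUnitSpace A] {K : ∀ n : ℕ, Set (Matrix (Fin n) (Fin n) A)}

/-- With `Z = f(a) Y` for a column `Y`, one has `Z* Z = f(Z* a Y)`, and `Z* a Y` is `‖Z‖ ‖Y‖` times
an element of `K 1`. Hence `‖Z‖ ^ 2 ≤ ε ‖Z‖ ‖Y‖`. -/
lemma norm_map_le_of_le_on_one (hK : IsMatrixMetricSet K) {f : A →ₗ[ℂ] ℂ} {ε : ℝ} (hε : 0 ≤ ε)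
    (hf : ∀ k ∈ K 1, ‖f (k 0 0)‖ ≤ ε) {r : ℕ} (hr : 0 < r) {a : Matrix (Fin r) (Fin r) A}
    (ha : a ∈ K r) : ‖a.map f‖ ≤ ε := by
  refine norm_le_of_mul_col hε fun Y => ?_
  set Z := a.map f * Y with hZ
  have e : (Zᴴ * Z) 0 0 = f (sandwich Zᴴ a Y 0 0) := by
    simp only [sandwich_apply, map_sum, map_smul, smul_eq_mul, Matrix.mul_apply, Finset.mul_sum, hZ,
      Matrix.map_apply]
    refine Finset.sum_congr rfl fun k _ => Finset.sum_congr rfl fun l _ => ?_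
    ring
  have h := Matrix.l2_opNorm_conjTranspose_mul_self Z
  obtain ⟨k, hk, e'⟩ := hK.exists_smul_eq_sandwich hr one_pos Zᴴ Y ha
  rw [norm_matrix_one_one, e, e', Matrix.smul_apply, map_smul, norm_smul, Complex.norm_real,
    Matrix.l2_opNorm_conjTranspose, Real.norm_of_nonneg (by positivity)] at h
  have h' := mul_le_mul_of_nonneg_left (hf k hk) (by positivity : 0 ≤ ‖Z‖ * ‖Y‖)
  rw [h] at h'
  rcases (norm_nonneg Z).eq_or_lt with h0 | h0
  · rw [← h0]; positivity
  · refine le_of_mul_le_mul_left ?_ h0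
    linarith

lemma stateDist_le (hK : IsMatrixMetricSet K) {n : ℕ} {φ ψ : MatrixState A n} {ε : ℝ} (hε : 0 ≤ ε)
    (h : ∀ k ∈ K 1, ∀ i j, ‖φ.1 (k 0 0) i j - ψ.1 (k 0 0) i j‖ ≤ ε) :
    stateDist K n φ ψ ≤ ENNReal.ofReal (n * (n * ε)) := by
  refine iSup_le fun r => iSup_le fun hr => iSup₂_le fun a ha => ?_
  rw [← ofReal_norm]
  refine ENNReal.ofReal_le_ofReal ((norm_le_sum_norm_blocks hr _).trans ?_)
  have hB : ∀ i j, ‖(Matrix.of fun k l => (pairing φ.1 a - pairing ψ.1 a) (i, k) (j, l) :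
      Matrix (Fin r) (Fin r) ℂ)‖ ≤ ε := fun i j =>
    norm_map_le_of_le_on_one hK (f := (Matrix.entryLinearMap ℂ ℂ i j).comp (φ.1 - ψ.1)) hε
      (fun k hk => h k hk i j) hr ha
  calc _ ≤ ∑ _i : Fin n, ∑ _j : Fin n, ε :=
        Finset.sum_le_sum fun i _ => Finset.sum_le_sum fun j _ => hB i j
    _ = n * (n * ε) := by simp

lemma enorm_apply_sub_le_stateDist {n : ℕ} (φ ψ : MatrixState A n) {k : Matrix (Fin 1) (Fin 1) A}
    (hk : k ∈ K 1) (i j : Fin n) :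
    ‖φ.1 (k 0 0) i j - ψ.1 (k 0 0) i j‖ₑ ≤ stateDist K n φ ψ := by
  refine le_trans ?_ (le_iSup₂_of_le 1 one_pos (le_iSup₂_of_le k hk le_rfl))
  rw [← ofReal_norm, ← ofReal_norm]
  exact ENNReal.ofReal_le_ofReal
    (norm_apply_le_norm (pairing φ.1 k - pairing ψ.1 k) (i, 0) (j, 0))

lemma isCompact_entries (hK : IsMatrixMetricSet K) :
    IsCompact ((fun k : Matrix (Fin 1) (Fin 1) A => k 0 0) '' K 1) :=
  (hK.isCompact' one_pos).image (continuous_apply_apply 0 0)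

lemma stateDist_ne_top (hK : IsMatrixMetricSet K) {n : ℕ} (φ ψ : MatrixState A n) :
    stateDist K n φ ψ ≠ ∞ := by
  obtain ⟨C, hC⟩ := (isCompact_entries hK).isBounded.exists_norm_le
  have h : ∀ k ∈ K 1, ∀ i j, ‖φ.1 (k 0 0) i j - ψ.1 (k 0 0) i j‖ ≤ |C| + |C| := fun k hk i j => by
    have hk' : ‖k 0 0‖ ≤ |C| := (hC _ ⟨k, hk, rfl⟩).trans (le_abs_self C)
    exact (norm_sub_le _ _).trans (add_le_add ((φ.norm_apply_le _ i j).trans hk')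
      ((ψ.norm_apply_le _ i j).trans hk'))
  exact ne_top_of_le_ne_top ENNReal.ofReal_ne_top (stateDist_le hK (by positivity) h)

/-- The span of the order unit and the entries of the matrices of size one in `K` is dense. -/
lemma dense_span_insert_one (hK : IsMatrixMetricSet K) :
    Dense (Submodule.span ℂ (insert 1 ((fun k : Matrix (Fin 1) (Fin 1) A => k 0 0) '' K 1)) :
      Set A) := by
  refine dense_of_separates_states _ (Submodule.subset_span (Set.mem_insert _ _)) (fun a ha => ?_)
    fun φ ψ h => ?_
  · induction ha using Submodule.span_induction with
    | mem a ha =>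
      rcases ha with rfl | ⟨k, hk, rfl⟩
      · rw [MatrixOrderUnitSpace.star_one]
        exact Submodule.subset_span (Set.mem_insert _ _)
      · exact Submodule.subset_span (Or.inr ⟨kᴴ, hK.star_mem 1 one_pos k hk, rfl⟩)
    | zero => simp
    | add a b _ _ ha hb => rw [star_add]; exact add_mem ha hb
    | smul c a _ ha => rw [star_smul]; exact Submodule.smul_mem _ _ ha
  · by_contra hne
    obtain ⟨r, hr, a, ha, hne⟩ := hK.separates 1 one_pos φ ψ hne
    apply hne
    -- The level-one estimate with `ε = 0`: agreement on `K 1` already forces agreement on every `K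
    -- r`.
    have h0 : a.map ((Matrix.entryLinearMap ℂ ℂ 0 0).comp (φ.1 - ψ.1)) = 0 := by
      refine norm_le_zero_iff.1 (norm_map_le_of_le_on_one hK le_rfl (fun k hk => ?_) hr ha)
      have := h (k 0 0) (Submodule.subset_span (Or.inr ⟨k, hk, rfl⟩))
      simp [this]
    ext ⟨i, k⟩ ⟨j, l⟩
    fin_cases i; fin_cases j
    have := congrFun (congrFun h0 k) l
    rw [Matrix.map_apply] at this
    exact sub_eq_zero.1 this

lemma dense_gaugeOf_lt_top (hK : IsMatrixMetricSet K) (h0 : ∀ n, 0 < n → 0 ∈ K n) :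
    Dense {a : A | gaugeOf K 1 !![a] < ∞} := by
  have hG := isMatrixGauge_gaugeOf hK h0
  refine (dense_span_insert_one hK).mono fun a ha => ?_
  rw [Set.mem_ofPred_eq]
  induction ha using Submodule.span_induction with
  | mem a ha =>
    rcases ha with rfl | ⟨k, hk, rfl⟩
    · refine ((gaugeOf_eq_zero_iff hK h0 one_pos _).2 ⟨1, ?_⟩).trans_lt ENNReal.zero_lt_top
      ext i j
      fin_cases i; fin_cases j
      simp
    · refine lt_of_le_of_lt ((gaugeOf_le_iff (t := 1) hK one_pos).2 ⟨k, hk, 0, ?_⟩)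
        ENNReal.coe_lt_top
      ext i j
      fin_cases i; fin_cases j
      simp
  | zero =>
    refine ((gaugeOf_eq_zero_iff hK h0 one_pos _).2 ⟨0, ?_⟩).trans_lt ENNReal.zero_lt_top
    ext i j
    fin_cases i; fin_cases j
    simp
  | add a b _ _ ha hb =>
    have e : !![a + b] = !![a] + !![b] := by
      ext i j
      fin_cases i; fin_cases j
      rfl
    rw [e]
    exact (hG.add_le 1 one_pos _ _).trans_lt (ENNReal.add_lt_top.2 ⟨ha, hb⟩)
  | smul c a _ ha =>
    have e : !![c • a] = c • !![a] := by
      ext i j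
      fin_cases i; fin_cases j
      rfl
    rw [e, hG.smul_eq 1 one_pos]
    exact ENNReal.mul_lt_top enorm_lt_top ha

/-- Evaluations at elements of `K 1` are 1-Lipschitz for the distance; those on the span are then
continuous, and those at any `a` are uniform limits of them because states are contractive. -/
lemma stateTopology_le_bwTopology (hK : IsMatrixMetricSet K) (n : ℕ) :
    stateTopology K n ≤ bwTopology A n := by
  let _ := stateEMetric K n
  refine continuous_iff_le_induced.1 (continuous_pi fun a => continuous_pi fun i =>
    continuous_pi fun j => ?_)
  have hspan : ∀ a ∈ Submodule.span ℂ
      (insert 1 ((fun k : Matrix (Fin 1) (Fin 1) A => k 0 0) '' K 1)),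
      Continuous fun φ : MatrixState A n => φ.1 a i j := by
    intro a ha
    induction ha using Submodule.span_induction with
    | mem a ha =>
      rcases ha with rfl | ⟨k, hk, rfl⟩
      · simp only [fun φ : MatrixState A n => φ.2.1]
        exact continuous_const
      · have hl : LipschitzWith 1 fun φ : MatrixState A n => φ.1 (k 0 0) i j := fun φ ψ => by
          rw [edist_eq_enorm_sub, ENNReal.coe_one, one_mul]
          exact enorm_apply_sub_le_stateDist φ ψ hk i j
        exact hl.continuous
    | zero => simpa using continuous_const
    | add a b _ _ ha hb =>
      simp only [map_add, Matrix.add_apply]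
      exact Continuous.add ha hb
    | smul c a _ ha => simpa using ha.const_mul c
  refine continuous_of_uniform_approx_of_continuous fun u hu => ?_
  obtain ⟨ε, hε, hu⟩ := Metric.mem_uniformity_dist.1 hu
  obtain ⟨b, hb, hab⟩ := Metric.dense_iff.1 (dense_span_insert_one hK) a ε hε
  refine ⟨_, hspan b hab, fun φ => hu ?_⟩
  rw [dist_eq_norm, ← Matrix.sub_apply, ← map_sub]
  refine (φ.norm_apply_le _ i j).trans_lt ?_
  rwa [← dist_eq_norm, dist_comm]

/-- A finite `δ`-net of `K 1` turns closeness at finitely many points into `3δ`-closeness on all of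
`K 1`, hence into a small distance. -/
lemma bwTopology_le_stateTopology (hK : IsMatrixMetricSet K) (n : ℕ) :
    bwTopology A n ≤ stateTopology K n := by
  rw [← continuous_id_iff_le]
  refine @continuous_iff_continuousAt _ _ (bwTopology A n) (stateTopology K n) _ |>.2 fun φ => ?_
  refine (@EMetric.tendsto_nhds _ _ (stateEMetric K n) _ _ _).2 fun ε hε => ?_
  obtain ⟨δ, hδ, hδε⟩ : ∃ δ : ℝ, 0 < δ ∧ ENNReal.ofReal (n * (n * (3 * δ))) < ε := by
    have : Filter.Tendsto (fun δ : ℝ => ENNReal.ofReal (n * (n * (3 * δ)))) (nhds 0) (nhds 0) := by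
      have hc : Continuous fun δ : ℝ => ENNReal.ofReal (n * (n * (3 * δ))) :=
        ENNReal.continuous_ofReal.comp (by fun_prop)
      simpa using hc.tendsto 0
    have h : ∀ᶠ δ : ℝ in nhdsWithin 0 (Set.Ioi 0), ENNReal.ofReal (n * (n * (3 * δ))) < ε :=
      (this.mono_left nhdsWithin_le_nhds).eventually_lt_const hε
    obtain ⟨δ, h, hδ⟩ := (h.and self_mem_nhdsWithin).exists
    exact ⟨δ, hδ, h⟩
  obtain ⟨t, -, ht, hcover⟩ := (isCompact_entries hK).finite_cover_balls hδ
  have hcont : ∀ (a : A) (i j : Fin n), @Continuous _ _ (bwTopology A n) _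
      fun ψ : MatrixState A n => ψ.1 a i j := fun a i j =>
    let _ := bwTopology A n
    have h : Continuous fun (ψ : MatrixState A n) (a : A) (i j : Fin n) => ψ.1 a i j :=
      continuous_induced_dom
    (continuous_apply j).comp ((continuous_apply i).comp ((continuous_apply a).comp h))
  have hev : ∀ᶠ ψ in @nhds _ (bwTopology A n) φ, ∀ a ∈ t, ∀ i j,
      ‖ψ.1 a i j - φ.1 a i j‖ < δ := by
    refine (Filter.eventually_all_finite ht).2 fun a _ => Filter.eventually_all.2 fun i =>
      Filter.eventually_all.2 fun j => ?_
    have h := (@Continuous.tendsto _ _ (bwTopology A n) _ _ (hcont a i j) φ)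
    simpa only [dist_eq_norm] using (Metric.tendsto_nhds.1 h) δ hδ
  filter_upwards [hev] with ψ hψ
  refine lt_of_le_of_lt ?_ hδε
  refine stateDist_le hK (by positivity) fun k hk i j => ?_
  obtain ⟨a, hat, hka⟩ := Set.mem_iUnion₂.1 (hcover ⟨k, hk, rfl⟩)
  have hka' : ‖k 0 0 - a‖ < δ := by rwa [← dist_eq_norm]
  have h₁ := (ψ.norm_apply_le (k 0 0 - a) i j).trans_lt hka'
  have h₂ := (φ.norm_apply_le (k 0 0 - a) i j).trans_lt hka'
  have h₃ := hψ a hat i j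
  rw [map_sub, Matrix.sub_apply] at h₁ h₂
  have e : ψ.1 (k 0 0) i j - φ.1 (k 0 0) i j = (ψ.1 (k 0 0) i j - ψ.1 a i j) +
      (ψ.1 a i j - φ.1 a i j) - (φ.1 (k 0 0) i j - φ.1 a i j) := by ring
  change ‖ψ.1 (k 0 0) i j - φ.1 (k 0 0) i j‖ ≤ 3 * δ
  rw [e]
  refine (norm_sub_le _ _).trans ?_
  have h₄ := norm_add_le (ψ.1 (k 0 0) i j - ψ.1 a i j) (ψ.1 a i j - φ.1 a i j)
  linarith

lemma stateTopology_congr {S T : ∀ r : ℕ, Set (Matrix (Fin r) (Fin r) A)} {n : ℕ}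
    (h : ∀ φ ψ, stateDist S n φ ψ = stateDist T n φ ψ) : stateTopology S n = stateTopology T n := by
  refine congrArg (fun m : PseudoEMetricSpace (MatrixState A n) =>
    m.toUniformSpace.toTopologicalSpace) (PseudoEMetricSpace.ext ?_)
  ext φ ψ
  exact h φ ψ

lemma isMatrixLipGauge_gaugeOf (hK : IsMatrixMetricSet K) (h0 : ∀ n, 0 < n → 0 ∈ K n) :
    IsMatrixLipGauge (gaugeOf K) where
  toIsMatrixGauge := isMatrixGauge_gaugeOf hK h0
  eq_zero_iff _ hn v := gaugeOf_eq_zero_iff hK h0 hn v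
  star_eq _ hn v := gaugeOf_conjTranspose hK hn v
  dense := dense_gaugeOf_lt_top hK h0
  topology_eq n _ := (stateTopology_congr (stateDist_unitBall_gaugeOf hK n)).trans
    (le_antisymm (stateTopology_le_bwTopology hK n) (bwTopology_le_stateTopology hK n))

end Topology

end MatOrd

theorem corollary4p4 {A : Type*} [NormedAddCommGroup A] [NormedSpace ℂ A] [StarAddMonoid A]
    [StarModule ℂ A] [One A] [MatOrd.MatrixOrderUnitSpace A] [CompleteSpace A]
    (K : ∀ n : ℕ, Set (Matrix (Fin n) (Fin n) A)) (hK : MatOrd.IsMatrixMetricSet K) :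
    ∃ L : ∀ n : ℕ, Matrix (Fin n) (Fin n) A → ℝ≥0∞,
      MatOrd.IsMatrixLipGauge L ∧
      (∀ n : ℕ, 0 < n → @LowerSemicontinuous _ _ (MatOrd.normTopology A n) _ (L n)) ∧
      ∀ n : ℕ, 0 < n → ∀ φ ψ : MatOrd.MatrixState A n,
        MatOrd.stateDist K n φ ψ ≠ ∞ ∧
        MatOrd.stateDist K n φ ψ = MatOrd.stateDist (MatOrd.unitBall L) n φ ψ := by
  -- Adjoining `0` leaves all distances unchanged, so the gauge of the enlarged set serves for `K`.
  have hK' := hK.insert_zero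
  have h0 : ∀ n, 0 < n → (0 : Matrix (Fin n) (Fin n) A) ∈ insert 0 (K n) :=
    fun n _ => Set.mem_insert _ _
  refine ⟨MatOrd.gaugeOf fun n => insert 0 (K n), MatOrd.isMatrixLipGauge_gaugeOf hK' h0,
    fun n hn => ?_, fun n _ φ ψ => ⟨MatOrd.stateDist_ne_top hK φ ψ, ?_⟩⟩
  · rw [MatOrd.normTopology_eq]
    exact MatOrd.lowerSemicontinuous_gaugeOf hK' hn
  · rw [MatOrd.stateDist_unitBall_gaugeOf hK', MatOrd.stateDist_insert_zero]
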